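/- \textbf{Setting.} Let $V$ be a finite set. A \emph{probabilistic causal model} $M$ over $V$ consists of a finite family $U$ of unobserved variables (with arbitrary measurable domains) with a joint probability distribution, a finite nonempty domain for each $v\in V$, and functions $f_v$ ($v\in V$), each defined in terms of some of the variables in $U\cup(V\setminus\{v\})$. Its induced graph has an edge $w\to v$ if $f_v$ is defined in terms of $w$, and an edge $v\leftrightarrow w$ ($v\ne w$) if some $u\in U$ appears in both $f_v$ and $f_w$. The model is \emph{semi-Markovian} if the unobserved variables are mutually independent, each of them appears in at most two of the functions, and the directed part of the induced graph is acyclic. A \emph{semi-Markovian graph (SMG)} is a graph with directed edges that form no cycle and with bidirected edges between distinct vertices. $P=P(V)$ is the distribution of the observed variables. $P_x(y)$ is the probability of $Y=y$ in the submodel in which $f_v$ is replaced by the constant $x_v$ for each $v\in X$. The effect $P_x(y)$ is \emph{identifiable from $P$ in $G$} if any two semi-Markovian models with the same domains that induce $G$ and have the same strictly positive distribution $P(V)$ have the same $P_x(y)$, for all $x,y$. For $S\subseteq V$, $G[S]$ is the induced subgraph (with its bidirected edges). The \emph{latent projection} $L(G,S)$ is the graph on $S$ with, for distinct $v,w\in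 S$, an edge $v\to w$ if $G$ has a directed path from $v$ to $w$ with all inner vertices outside $S$, and an edge $v\leftrightarrow w$ if $G$ has a path between $v$ and $w$ without colliders, with all inner vertices outside $S$, whose first edge has an arrowhead at $v$ and whose last edge has an arrowhead at $w$. \textbf{Theorem.} Let $G$ be an SMG on $V$ and let $X,Y\subseteq V$ be disjoint. Let $Z$ be the set of all $z\in V$ such that $X$ intercepts all paths from $z$ to $Y$, i.e. every path of $G$ from $z$ to a vertex of $Y$ (edges of any kind and direction, length zero included) contains a vertex of $X$ other than its starting point $z$. Suppose that $Z\cap X=\emptyset$ and that $G[V\setminus Z]=L(G,V\setminus Z)$. Then the causal effect $P_x(y)$ obtained from $P$ in $G$ is equal to the causal effect $P'_x(y)$ obtained from $P'=P(V\setminus Z)$ in $G[V\setminus Z]$. Precisely: \begin{enumerate} \item The effect of $X$ on $Y$ is identifiable from $P$ in $G$ if and only if it is identifiable from $P'$ in $G[V\setminus Z]$. \item Let $M$ be a semi-Markovian model that induces $G$, with distribution $P$ and causal effect $P_x(y)$. There is a causal model over $V\setminus Z$ with mutually independent unobserved variables that induces $G[V\setminus Z]$, has the observed distribution $P'=P(V\setminus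 Z)$, and has the causal effect $P'_x(y)=P_x(y)$ for all $x,y$. \item If the effect is identifiable from $P'$ in $G[V\setminus Z]$, then for every $M$ as in 2 for which $P'$ is strictly positive, every causal model with mutually independent unobserved variables (in particular, every semi-Markovian one) that induces $G[V\setminus Z]$ and has the observed distribution $P'=P(V\setminus Z)$ satisfies $P'_x(y)=P_x(y)$ for all $x,y$. \end{enumerate} -/

import Mathlib

/-- A graph with directed edges `v → w` and bidirected edges `v ↔ w`. -/
@[ext]
structure MixedGraph (V : Type) where
  /-- `dir v w` is the edge `v → w`. -/
  dir : V → V → Prop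
  /-- `bi v w` is the edge `v ↔ w`. -/
  bi : V → V → Prop

namespace MixedGraph

variable {V : Type} (G : MixedGraph V)

/-- Semi-Markovian graphs: no directed cycles, and `↔` is a genuine undirected relation between
distinct vertices (an edge `v ↔ w` abbreviates `v ← U → w` with `U` unobserved). -/
structure IsSMG : Prop where
  acyclic : ∀ v, ¬ Relation.TransGen G.dir v v
  bi_symm : ∀ v w, G.bi v w → G.bi w v
  bi_irrefl : ∀ v, ¬ G.bi v v

/-- The subgraph induced by `S`; it keeps the directed and the bidirected edges inside `S`. -/
def induce (S : Set V) : MixedGraph S where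
  dir v w := G.dir v w
  bi v w := G.bi v w

/-- The graph in which the type and the directionality of the edges are forgotten. -/
def skeleton : SimpleGraph V where
  Adj v w := v ≠ w ∧ (G.dir v w ∨ G.dir w v ∨ G.bi v w ∨ G.bi w v)
  symm := ⟨fun _ _ h => ⟨h.1.symm, by tauto⟩⟩
  loopless := ⟨fun _ h => h.1 rfl⟩

/-- The set of all vertices `z` such that `X` intercepts every path from `z` to `Y`: every path
(edges of any type and direction, length zero included) from `z` to a vertex of `Y` contains a
vertex of `X` other than its starting point `z`. -/
def intercepted (X Y : Set V) : Set V :=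
  {z | ∀ y ∈ Y, ∀ p : G.skeleton.Walk z y, p.IsPath → ∃ x ∈ p.support, x ∈ X ∧ x ≠ z}

/-- There is a directed walk `v → ⋯ → w` with at least one edge and all of whose inner vertices
lie outside `S`. -/
inductive DirWalk (S : Set V) : V → V → Prop
  | edge {v w : V} : G.dir v w → DirWalk S v w
  | snoc {v m w : V} : DirWalk S v m → m ∉ S → G.dir m w → DirWalk S v w

/-- `G.Edge v a w b`: there is an edge between `v` and `w` that has an arrowhead at `v` iff
`a = true`, and an arrowhead at `w` iff `b = true`. -/
inductive Edge : V → Bool → V → Bool → Prop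
  | right {v w : V} : G.dir v w → Edge v false w true
  | left {v w : V} : G.dir w v → Edge v true w false
  | both {v w : V} : G.bi v w → Edge v true w true

/-- `G.OpenWalk S v a w b`: there is a walk from `v` to `w` without colliders, all of whose inner
vertices lie outside `S`; its first edge has an arrowhead at `v` iff `a = true`, and its last edge
has an arrowhead at `w` iff `b = true`. -/
inductive OpenWalk (S : Set V) : V → Bool → V → Bool → Prop
  | edge {v w : V} {a b : Bool} : G.Edge v a w b → OpenWalk S v a w b
  | snoc {v m w : V} {a b c d : Bool} : OpenWalk S v a m b → m ∉ S → ¬ (b = true ∧ c = true) →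
      G.Edge m c w d → OpenWalk S v a w d

/-- The latent projection onto `S`, the vertices outside `S` being latent. Between two distinct
vertices of `S`, walks as above exist iff paths (without repeated vertices) of the same kind do,
as the directed edges of an SMG form no cycle and a vertex that is common to the two directed
branches of a collider-free walk can be used as the top of a shorter one. -/
def latentProjection (S : Set V) : MixedGraph S where
  dir v w := v ≠ w ∧ G.DirWalk S v w
  bi v w := v ≠ w ∧ G.OpenWalk S v true w true

end MixedGraph

open MeasureTheory ProbabilityTheory in
/-- Probabilistic causal models with observed variables `V`, the variable `v` having the domain
`α v`. The sets `pa v` and `upa v` are the observed and unobserved variables in terms of which the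
function `f v` is defined. -/
structure CausalModel {V : Type} (α : V → Type) where
  /-- the unobserved variables -/
  U : Type
  [fintypeU : Fintype U]
  /-- the domains of the unobserved variables -/
  dom : U → Type
  [measurableDom : ∀ i, MeasurableSpace (dom i)]
  /-- the joint distribution of the unobserved variables -/
  P : Measure (∀ i, dom i)
  [isProbabilityMeasure : IsProbabilityMeasure P]
  pa : V → Set V
  upa : V → Set U
  f : ∀ v, (∀ w, α w) → (∀ i, dom i) → α v
  self_notMem_pa : ∀ v, v ∉ pa v
  f_congr : ∀ v a a' u u', (∀ w ∈ pa v, a w = a' w) → (∀ i ∈ upa v, u i = u' i) →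
    f v a u = f v a' u'
  measurableSet_f : ∀ v a (s : α v), MeasurableSet {u | f v a u = s}

namespace CausalModel

attribute [instance] fintypeU measurableDom isProbabilityMeasure

variable {V : Type} {α : V → Type} (M : CausalModel α)

/-- The values `a` of the observed variables satisfy all structural equations when the unobserved
variables have the values `u`. -/
def IsSolution (u : ∀ i, M.dom i) (a : ∀ v, α v) : Prop := ∀ v, a v = M.f v a u

/-- The graph of the model over the observed variables: `w → v` if `f v` is defined in terms of
`w`, and `v ↔ w` if `f v` and `f w` have an unobserved variable in common. -/
def inducedGraph : MixedGraph V where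
  dir w v := w ∈ M.pa v
  bi v w := v ≠ w ∧ ∃ i, i ∈ M.upa v ∧ i ∈ M.upa w

/-- The unobserved variables are mutually independent. -/
def Independent : Prop :=
  ProbabilityTheory.iIndepFun (fun (i : M.U) (u : ∀ i, M.dom i) => u i) M.P

/-- Semi-Markovian models: the unobserved variables are mutually independent, each of them appears
in at most two functions, and the induced graph is acyclic. -/
structure IsSemiMarkovian : Prop where
  independent : M.Independent
  encard_le_two : ∀ i, {v | i ∈ M.upa v}.encard ≤ 2
  acyclic : ∀ v, ¬ Relation.TransGen M.inducedGraph.dir v v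

/-- In an acyclic model the structural equations form a mapping from the unobserved to the observed
variables. -/
theorem existsUnique_isSolution [Finite V] [∀ v, Nonempty (α v)]
    (h : ∀ v, ¬ Relation.TransGen M.inducedGraph.dir v v) (u : ∀ i, M.dom i) :
    ∃! a, M.IsSolution u a := by
  classical
  let r := Relation.TransGen M.inducedGraph.dir
  have : Std.Irrefl r := ⟨h⟩
  have : IsTrans V r := ⟨fun _ _ _ => Relation.TransGen.trans⟩
  have wf : WellFounded r := Finite.wellFounded_of_trans_of_irrefl r
  let F : ∀ v, (∀ w, r w v → α w) → α v := fun v g =>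
    M.f v (fun w => if hw : r w v then g w hw else Classical.arbitrary (α w)) u
  refine ⟨wf.fix F, fun v => ?_, fun b hb => funext fun v => ?_⟩
  · rw [wf.fix_eq]
    refine M.f_congr v _ _ _ _ (fun w hw => ?_) (fun _ _ => rfl)
    have : r w v := Relation.TransGen.single hw
    simp [this]
  · induction v using wf.induction with
    | _ v ih =>
      rw [wf.fix_eq, hb v]
      refine M.f_congr v _ _ _ _ (fun w hw => ?_) (fun _ _ => rfl)
      have hr : r w v := Relation.TransGen.single hw
      simp [hr, ih w hr]

/-- The probability that the observed variables take a value in `E`. -/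
noncomputable def prob (E : Set (∀ v, α v)) : ℝ :=
  M.P.real {u | ∃ a ∈ E, M.IsSolution u a}

/-- The observational distribution `P(v)`, at the value `a`. -/
noncomputable def obs (a : ∀ v, α v) : ℝ := M.prob {a}

/-- The marginal observational distribution of the variables in `S`, at the value `b`. -/
noncomputable def marginal (S : Set V) (b : ∀ v : S, α v) : ℝ :=
  M.prob {a | ∀ v : S, a v = b v}

/-- The observational distribution is strictly positive. -/
def Positive : Prop := ∀ a, 0 < M.obs a

open Classical in
/-- The submodel of the intervention `do(x)`: for each `v` in `X` the function of `v` is replaced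
with the constant `x v`. -/
noncomputable def intervene (X : Set V) (x : ∀ v, α v) : CausalModel α where
  U := M.U
  dom := M.dom
  P := M.P
  pa v := if v ∈ X then ∅ else M.pa v
  upa v := if v ∈ X then ∅ else M.upa v
  f v a u := if v ∈ X then x v else M.f v a u
  self_notMem_pa v := by
    split_ifs
    · simp
    · exact M.self_notMem_pa v
  f_congr v a a' u u' := by
    split_ifs
    · exact fun _ _ => rfl
    · exact M.f_congr v a a' u u'
  measurableSet_f v a s := by
    split_ifs
    · exact MeasurableSet.const _
    · exact M.measurableSet_f v a s

/-- The causal effect `P_x(y)`. Only the values of `x` on `X` and of `y` on `Y` matter. -/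
noncomputable def effect (X : Set V) (x : ∀ v, α v) (Y : Set V) (y : ∀ v, α v) : ℝ :=
  (M.intervene X x).marginal Y (fun v => y v)

end CausalModel

/-- `P_x(y)` is identifiable from `P` in the SMG `G`: any two semi-Markovian models (over the same
finite domains) that induce `G` and have the same strictly positive observational distribution have
the same causal effect of `X` on `Y`. -/
def Identifiable {V : Type} (G : MixedGraph V) (X Y : Set V) : Prop :=
  ∀ (α : V → Type) [∀ v, Finite (α v)] [∀ v, Nonempty (α v)] (M₁ M₂ : CausalModel α),
    M₁.IsSemiMarkovian → M₁.inducedGraph = G → M₁.Positive →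
    M₂.IsSemiMarkovian → M₂.inducedGraph = G → M₂.Positive →
    (∀ a, M₁.obs a = M₂.obs a) →
    ∀ x y, M₁.effect X x Y y = M₂.effect X x Y y

/-!
The vertices of `Z` are eliminated from a semi-Markovian model over `V` by substitution: each
function over `V \ Z` reads off the values of the variables in `Z` that it needs from the solution
of their structural equations (`CausalModel.project`). This changes neither the marginal
distribution of `V \ Z` nor the effect of `X` on `Y`. The graph of the resulting model is the
latent projection, which is `G[V \ Z]` by hypothesis. The unobserved variables remain independent,
but one of them may come to appear in more than two functions, so that the result need not be
semi-Markovian. In the other direction, a semi-Markovian model over `V \ Z` becomes one over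
`V` if the variables in `Z` are given trivial domains (`CausalModel.extend`).

What remains is that identifiability, which is a statement about semi-Markovian models, determines
the effects in all models with independent unobserved variables (`Identifiable.effect_eq`). This is
a form of the hedge criterion.

* If two models with independent unobserved variables have the same positive observational
  distribution but distinct effects, there is a hedge (`MixedGraph.exists_isHedge`). The argument is
  Tian's algorithm: the sets `S` for which the c-factors `Q[S]` of the two models agree are closed
  under the removal of childless vertices, under the passage to parts without bidirected edges to
  the rest, and under unions of parts without bidirected edges in between. If they do not include
  the set `D` of the ancestors of `Y` outside `X`, then some bidirected component `E` of `D` is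
  not among them, either; a minimal set `T ⊇ E` among them completes the hedge.

* If there is a hedge, there are two semi-Markovian models with the same positive observational
  distribution but distinct effects (`MixedGraph.IsHedge.not_identifiable`). In both of them the
  vertices carry parities of random bits. In one, the bits of all of `T` flow into `E`, and those of
  the bidirected edges cancel unless an intervention on `X` interrupts the flow; in the other, `E`
  is separate from the rest of `T`. The total parity of `E` is passed on to `Y`.
-/

/-! ### c-factors -/

/-- A nonempty finite set of vertices of an acyclic graph has a vertex without children in it. -/
theorem MixedGraph.exists_childless {V : Type} [Finite V] {G : MixedGraph V}
    (hG : ∀ v, ¬ Relation.TransGen G.dir v v) {S : Set V} (hS : S.Nonempty) :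
    ∃ v ∈ S, ∀ w ∈ S, ¬ G.dir v w := by
  let r := fun a b => Relation.TransGen G.dir b a
  have : Std.Irrefl r := ⟨hG⟩
  have : IsTrans V r := ⟨fun _ _ _ h₁ h₂ => Relation.TransGen.trans h₂ h₁⟩
  have wf : WellFounded r := Finite.wellFounded_of_trans_of_irrefl r
  obtain ⟨v, hv, h⟩ := wf.has_min S hS
  exact ⟨v, hv, fun w hw hvw => h w hw (.single hvw)⟩

namespace CausalModel

variable {V : Type} {α : V → Type} (M : CausalModel α)

/-- The c-factor `Q[S](a)`: the probability that the functions of the variables in `S` return the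
values prescribed by `a` when their observed arguments are read off from `a`. In an acyclic model
it is the probability of `S = a` under the intervention that sets all variables outside `S`
to `a`. -/
noncomputable def cFactor (S : Set V) (a : ∀ v, α v) : ℝ :=
  M.P.real {u | ∀ v ∈ S, M.f v a u = a v}

theorem cFactor_univ (a : ∀ v, α v) : M.cFactor Set.univ a = M.obs a := by
  unfold cFactor obs prob IsSolution
  congr 1
  ext u
  simp [eq_comm]

theorem cFactor_empty (a : ∀ v, α v) : M.cFactor ∅ a = 1 := by
  simp [cFactor]

theorem measurableSet_forall_f [Finite V] (S : Set V) (a : ∀ v, α v) :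
    MeasurableSet {u | ∀ v ∈ S, M.f v a u = a v} := by
  have : {u | ∀ v ∈ S, M.f v a u = a v} = ⋂ v ∈ S, {u | M.f v a u = a v} := by
    ext; simp
  rw [this]
  exact MeasurableSet.biInter S.to_countable fun v _ => M.measurableSet_f v a (a v)

theorem cFactor_pos (hM : M.Positive) (S : Set V) (a : ∀ v, α v) : 0 < M.cFactor S a := by
  refine (hM a).trans_le ?_
  rw [← cFactor_univ]
  exact MeasureTheory.measureReal_mono fun u hu v _ => hu v (Set.mem_univ v)

open MeasureTheory ProbabilityTheory in
/-- Events that depend on disjoint sets of independent unobserved variables are independent. -/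
theorem measureReal_inter_eq_mul (hI : M.Independent) {A B : Set (∀ i, M.dom i)} {I J : Set M.U}
    (hIJ : Disjoint I J) (hA : MeasurableSet A) (hB : MeasurableSet B)
    (hAI : ∀ u u', (∀ i ∈ I, u i = u' i) → u ∈ A → u' ∈ A)
    (hBJ : ∀ u u', (∀ i ∈ J, u i = u' i) → u ∈ B → u' ∈ B) :
    M.P.real (A ∩ B) = M.P.real A * M.P.real B := by
  classical
  obtain ⟨u₀⟩ : Nonempty (∀ i, M.dom i) := M.P.nonempty_of_neZero
  have hd : Disjoint I.toFinset J.toFinset := by simpa using hIJ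
  have hind := iIndepFun.indepFun_finset _ _ hd hI fun i => measurable_pi_apply i
  let ext (K : Set M.U) (z : ∀ i : K.toFinset, M.dom i) : ∀ i, M.dom i := fun i =>
    if h : i ∈ K.toFinset then z ⟨i, h⟩ else u₀ i
  have hext (K : Set M.U) : Measurable (ext K) := by
    refine measurable_pi_lambda _ fun i => ?_
    by_cases h : i ∈ K.toFinset
    · simpa only [ext, h, dite_true] using measurable_pi_apply _
    · simp only [ext, h, dite_false]
      exact measurable_const
  have hpre {K : Set M.U} {C : Set (∀ i, M.dom i)}
      (hCK : ∀ u u', (∀ i ∈ K, u i = u' i) → u ∈ C → u' ∈ C) :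
      C = (fun (u : ∀ i, M.dom i) (i : K.toFinset) => u i) ⁻¹' (ext K ⁻¹' C) := by
    ext u
    have h : ∀ i ∈ K, u i = ext K (fun i => u i) i := fun i hi => by simp [ext, hi]
    exact ⟨hCK _ _ h, hCK _ _ fun i hi => (h i hi).symm⟩
  have := hind.measure_inter_preimage_eq_mul _ _ (hext I hA) (hext J hB)
  rw [← hpre hAI, ← hpre hBJ] at this
  simp [Measure.real, this]

/-- Variables without common unobserved causes contribute independent factors. -/
theorem cFactor_union [Finite V] (hI : M.Independent) {S₁ S₂ : Set V} (hS : Disjoint S₁ S₂)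
    (hbi : ∀ v ∈ S₁, ∀ w ∈ S₂, ¬ M.inducedGraph.bi v w) (a : ∀ v, α v) :
    M.cFactor (S₁ ∪ S₂) a = M.cFactor S₁ a * M.cFactor S₂ a := by
  have h : {u | ∀ v ∈ S₁ ∪ S₂, M.f v a u = a v} =
      {u | ∀ v ∈ S₁, M.f v a u = a v} ∩ {u | ∀ v ∈ S₂, M.f v a u = a v} := by
    ext u
    simp [or_imp, forall_and]
  have hdep (S : Set V) (u u' : ∀ i, M.dom i) (huu : ∀ i ∈ ⋃ v ∈ S, M.upa v, u i = u' i)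
      (hu : u ∈ {u | ∀ v ∈ S, M.f v a u = a v}) : u' ∈ {u | ∀ v ∈ S, M.f v a u = a v} :=
    fun v hv => (M.f_congr v a a u' u (fun _ _ => rfl) fun i hi =>
      (huu i (Set.mem_biUnion hv hi)).symm).trans (hu v hv)
  unfold cFactor
  rw [h]
  refine M.measureReal_inter_eq_mul hI (I := ⋃ v ∈ S₁, M.upa v) (J := ⋃ v ∈ S₂, M.upa v) ?_
    (M.measurableSet_forall_f _ a) (M.measurableSet_forall_f _ a) (hdep S₁) (hdep S₂)
  rw [Set.disjoint_left]
  intro i h₁ h₂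
  simp only [Set.mem_iUnion] at h₁ h₂
  obtain ⟨v, hv, hiv⟩ := h₁
  obtain ⟨w, hw, hiw⟩ := h₂
  exact hbi v hv w hw ⟨fun e => Set.disjoint_left.1 hS hv (e ▸ hw), i, hiv, hiw⟩

open Classical in
/-- A variable that has no children in `S` can be summed out of `Q[S]`. -/
theorem sum_cFactor_update [Finite V] {S : Set V} {v : V} [Fintype (α v)] (hv : v ∈ S)
    (hc : ∀ w ∈ S, v ∉ M.pa w) (a : ∀ v, α v) :
    ∑ t, M.cFactor S (Function.update a v t) = M.cFactor (S \ {v}) a := by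
  have hf (t : α v) (w : V) (hw : w ∈ S) (u : ∀ i, M.dom i) :
      M.f w (Function.update a v t) u = M.f w a u :=
    M.f_congr w _ _ _ _ (fun w' hw' => Function.update_of_ne
      (by rintro rfl; exact hc w hw hw') _ _) fun _ _ => rfl
  unfold cFactor
  rw [← MeasureTheory.measureReal_iUnion_fintype]
  · congr 1
    ext u
    simp only [Set.mem_iUnion, Set.mem_ofPred_eq]
    constructor
    · rintro ⟨t, ht⟩ w ⟨hw, hwv⟩
      rw [← hf t w hw, ht w hw, Function.update_of_ne hwv]
    · refine fun h => ⟨M.f v a u, fun w hw => ?_⟩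
      rw [hf _ w hw]
      by_cases hwv : w = v
      · subst hwv
        simp
      · rw [Function.update_of_ne hwv, h w ⟨hw, hwv⟩]
  · intro s t hst
    refine Set.disjoint_left.2 fun u hs ht => hst ?_
    have hs' := hs v hv
    have ht' := ht v hv
    rw [hf _ v hv, Function.update_self] at hs' ht'
    exact hs'.symm.trans ht'
  · exact fun t => M.measurableSet_forall_f S _

theorem intervene_acyclic (h : ∀ v, ¬ Relation.TransGen M.inducedGraph.dir v v) (X : Set V)
    (x : ∀ v, α v) (v : V) : ¬ Relation.TransGen (M.intervene X x).inducedGraph.dir v v := by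
  refine fun hv => h v (Relation.TransGen.mono (fun w w' hw => ?_) _ _ hv)
  change w ∈ (M.intervene X x).pa w' at hw
  change w ∈ M.pa w'
  unfold intervene at hw
  dsimp only at hw
  split_ifs at hw
  · exact hw.elim
  · exact hw

theorem isSolution_intervene {X : Set V} {x : ∀ v, α v} {u : ∀ i, M.dom i} {a : ∀ v, α v} :
    (M.intervene X x).IsSolution u a ↔ (∀ v ∈ X, a v = x v) ∧ ∀ v ∉ X, a v = M.f v a u := by
  constructor
  · intro h
    refine ⟨fun v hv => (h v).trans ?_, fun v hv => (h v).trans ?_⟩ <;> simp [intervene, hv]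
  · rintro ⟨h₁, h₂⟩ v
    by_cases hv : v ∈ X
    · rw [h₁ v hv]
      simp [intervene, hv]
    · rw [h₂ v hv]
      simp [intervene, hv]

theorem prob_eq_sum_obs [Finite V] [∀ v, Finite (α v)] [∀ v, Nonempty (α v)]
    (h : ∀ v, ¬ Relation.TransGen M.inducedGraph.dir v v) (E : Set (∀ v, α v)) :
    M.prob E = ∑ a ∈ E.toFinite.toFinset, M.obs a := by
  have hs (a : ∀ v, α v) : {u | ∃ b ∈ ({a} : Set (∀ v, α v)), M.IsSolution u b} =
      {u | M.IsSolution u a} := by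
    ext u; simp
  simp only [obs, prob, hs]
  rw [← MeasureTheory.measureReal_biUnion_finset]
  · congr 1
    ext u
    simp
  · intro a _ b _ hab
    exact Set.disjoint_left.2 fun u ha hb => hab ((M.existsUnique_isSolution h u).unique ha hb)
  · intro a _
    have := M.measurableSet_forall_f Set.univ a
    simpa [IsSolution, eq_comm] using this

theorem obs_intervene (D : Set V) (r a : ∀ v, α v) [Decidable (∀ v ∈ Dᶜ, a v = r v)] :
    (M.intervene Dᶜ r).obs a = if ∀ v ∈ Dᶜ, a v = r v then M.cFactor D a else 0 := by
  have : (M.intervene Dᶜ r).obs a = M.P.real {u | (M.intervene Dᶜ r).IsSolution u a} := by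
    unfold obs prob
    congr 1
    ext u
    simp [intervene]
  rw [this]
  simp only [isSolution_intervene]
  split_ifs with h
  · unfold cFactor
    congr 1
    ext u
    simp only [Set.mem_compl_iff, not_not, Set.mem_ofPred_eq]
    exact ⟨fun h v hv => (h.2 v hv).symm, fun h' => ⟨h, fun v hv => (h' v hv).symm⟩⟩
  · refine (congrArg M.P.real (Set.eq_empty_of_forall_notMem fun u hu => h hu.1)).trans ?_
    simp

/-- If the ancestors of `Y` outside `X` belong to `D`, then the variables outside `X ∪ D` are
irrelevant for the effect of `X` on `Y`, and can be held fixed, too. -/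
theorem effect_eq_prob_intervene_compl [Finite V] [∀ v, Nonempty (α v)]
    (h : ∀ v, ¬ Relation.TransGen M.inducedGraph.dir v v) {X Y D : Set V} (hXD : Disjoint D X)
    (hYD : Y ⊆ D) (hD : ∀ v ∈ D, ∀ w ∈ M.pa v, w ∉ X → w ∈ D) (x y r : ∀ v, α v)
    (hr : ∀ v ∈ X, r v = x v) :
    M.effect X x Y y = (M.intervene Dᶜ r).prob {a | ∀ v : Y, a v = y v} := by
  classical
  have key (u : ∀ i, M.dom i) {a b : ∀ v, α v} (ha : (M.intervene X x).IsSolution u a)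
      (hb : (M.intervene Dᶜ r).IsSolution u b) : ∀ v ∈ D, a v = b v := by
    let c : ∀ v, α v := fun v => if v ∈ D then a v else r v
    suffices hc : (M.intervene Dᶜ r).IsSolution u c by
      have := (existsUnique_isSolution _ (M.intervene_acyclic h Dᶜ r) u).unique hb hc
      intro v hv
      simp [this, c, hv]
    rw [isSolution_intervene] at ha ⊢
    refine ⟨fun v hv => if_neg hv, fun v hv => ?_⟩
    have hv : v ∈ D := not_not.1 hv
    have hc : c v = a v := if_pos hv
    rw [hc, ha.2 v (Set.disjoint_left.1 hXD hv)]
    refine M.f_congr v _ _ _ _ (fun w hw => ?_) fun _ _ => rfl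
    by_cases hwD : w ∈ D
    · simp [c, hwD]
    · have hwX : w ∈ X := by_contra fun hwX => hwD (hD v hv w hw hwX)
      simp [c, hwD, hr w hwX, ha.1 w hwX]
  unfold effect marginal prob
  congr 1
  ext u
  constructor
  · rintro ⟨a, haY, ha⟩
    obtain ⟨b, hb, -⟩ := existsUnique_isSolution _ (M.intervene_acyclic h Dᶜ r) u
    exact ⟨b, fun v => (key u ha hb v (hYD v.2)).symm.trans (haY v), hb⟩
  · rintro ⟨b, hbY, hb⟩
    obtain ⟨a, ha, -⟩ := existsUnique_isSolution _ (M.intervene_acyclic h X x) u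
    exact ⟨a, fun v => (key u ha hb v (hYD v.2)).trans (hbY v), ha⟩

theorem effect_eq_of_cFactor_eq [Finite V] [∀ v, Finite (α v)] [∀ v, Nonempty (α v)]
    {M₁ M₂ : CausalModel α} {G : MixedGraph V} (hG : ∀ v, ¬ Relation.TransGen G.dir v v)
    (h₁ : M₁.inducedGraph = G) (h₂ : M₂.inducedGraph = G) {X Y D : Set V} (hXD : Disjoint D X)
    (hYD : Y ⊆ D) (hD : ∀ v ∈ D, ∀ w, G.dir w v → w ∉ X → w ∈ D)
    (h : ∀ a, M₁.cFactor D a = M₂.cFactor D a) (x y : ∀ v, α v) :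
    M₁.effect X x Y y = M₂.effect X x Y y := by
  classical
  have hpa {M : CausalModel α} (hM : M.inducedGraph = G) :
      M.effect X x Y y = (M.intervene Dᶜ x).prob {a | ∀ v : Y, a v = y v} :=
    M.effect_eq_prob_intervene_compl (hM ▸ hG) hXD hYD
      (fun v hv w hw => hD v hv w (by rw [← hM]; exact hw)) x y x fun _ _ => rfl
  rw [hpa h₁, hpa h₂, prob_eq_sum_obs _ (M₁.intervene_acyclic (h₁ ▸ hG) _ _),
    prob_eq_sum_obs _ (M₂.intervene_acyclic (h₂ ▸ hG) _ _)]
  simp only [obs_intervene, h]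

/-- If the c-factors of `S₁ ∪ S₂` agree, and no unobserved variable is shared between `S₁` and
`S₂`, then the c-factors of `S₁` and of `S₂` agree. They are recovered by summing out a childless
vertex of the union, and dividing by the c-factor of the part that does not contain it. -/
theorem cFactor_eq_of_union [Finite V] [∀ v, Finite (α v)] {M₁ M₂ : CausalModel α}
    {G : MixedGraph V} (hG : ∀ v, ¬ Relation.TransGen G.dir v v)
    (h₁ : M₁.inducedGraph = G) (h₂ : M₂.inducedGraph = G) (hI₁ : M₁.Independent)
    (hI₂ : M₂.Independent) (hP : M₂.Positive) {S : Set V}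
    (hS : ∀ a, M₁.cFactor S a = M₂.cFactor S a) :
    ∀ S₁ S₂ : Set V, S = S₁ ∪ S₂ → Disjoint S₁ S₂ →
      (∀ v ∈ S₁, ∀ w ∈ S₂, ¬ G.bi v w) → (∀ v ∈ S₁, ∀ w ∈ S₂, ¬ G.bi w v) →
      (∀ a, M₁.cFactor S₁ a = M₂.cFactor S₁ a) ∧ ∀ a, M₁.cFactor S₂ a = M₂.cFactor S₂ a := by
  classical
  have (v : V) : Fintype (α v) := Fintype.ofFinite _
  induction hn : S.ncard using Nat.strong_induction_on generalizing S with
  | _ n ih =>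
  -- the case where the childless vertex belongs to the first part
  have step (S₁ S₂ : Set V) (hU : S = S₁ ∪ S₂) (hd : Disjoint S₁ S₂)
      (hb : ∀ v ∈ S₁, ∀ w ∈ S₂, ¬ G.bi v w) (hb' : ∀ v ∈ S₁, ∀ w ∈ S₂, ¬ G.bi w v) (v : V)
      (hv : v ∈ S₁) (hc : ∀ w ∈ S, ¬ G.dir v w) :
      (∀ a, M₁.cFactor S₁ a = M₂.cFactor S₁ a) ∧ ∀ a, M₁.cFactor S₂ a = M₂.cFactor S₂ a := by
    have hvS : v ∈ S := hU ▸ Or.inl hv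
    have hlt : (S \ {v}).ncard < n := hn ▸ Set.ncard_sdiff_singleton_lt_of_mem hvS
    have hU' : S \ {v} = S₁ \ {v} ∪ S₂ := by
      rw [hU, Set.union_sdiff_distrib,
        Set.sdiff_singleton_eq_self (Set.disjoint_left.1 hd hv)]
    have hS' (a) : M₁.cFactor (S \ {v}) a = M₂.cFactor (S \ {v}) a := by
      rw [← M₁.sum_cFactor_update hvS, ← M₂.sum_cFactor_update hvS]
      · simp only [hS]
      · intro w hw h
        rw [← h₂] at hc
        exact hc w hw h
      · intro w hw h
        rw [← h₁] at hc
        exact hc w hw h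
    have h₂' := (ih _ hlt hS' rfl (S₁ \ {v}) S₂ hU' (hd.mono_left Set.sdiff_subset)
      (fun v hv => hb v hv.1) (fun v hv => hb' v hv.1)).2
    refine ⟨fun a => ?_, h₂'⟩
    have := hS a
    rw [hU, M₁.cFactor_union hI₁ hd (h₁ ▸ hb), M₂.cFactor_union hI₂ hd (h₂ ▸ hb), h₂' a] at this
    exact mul_right_cancel₀ (M₂.cFactor_pos hP S₂ a).ne' this
  intro S₁ S₂ hU hd hb hb'
  rcases S.eq_empty_or_nonempty with rfl | hne
  · obtain ⟨rfl, rfl⟩ := Set.union_empty_iff.1 hU.symm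
    simp [cFactor_empty]
  obtain ⟨v, hv, hc⟩ := MixedGraph.exists_childless hG hne
  rcases hU ▸ hv with hv | hv
  · exact step S₁ S₂ hU hd hb hb' v hv hc
  · exact (step S₂ S₁ (hU.trans (Set.union_comm _ _)) hd.symm (fun v hv w hw => hb' w hw v hv)
      (fun v hv w hw => hb w hw v hv) v hv hc).symm

end CausalModel

/-! ### Identification in the absence of hedges -/

namespace MixedGraph

variable {V : Type} (G : MixedGraph V)

/-- A set of vertices is connected by bidirected edges: no partition of it into two nonempty parts
separates the endpoints of all of them. -/
def BiConnected (S : Set V) : Prop :=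
  ∀ A ⊆ S, A.Nonempty → A ≠ S → ∃ v ∈ A, ∃ w ∈ S \ A, G.bi v w

/-- The obstruction to the identifiability of the effect of `X` on `Y`, in the role of the hedges of
Shpitser and Pearl. Each vertex of `D` has a directed path to `Y` in `D`, and each
vertex of `T` has a directed path to `E` in `T`; as the graphs considered are finite and acyclic,
it suffices to provide the next vertex of such a path. -/
structure IsHedge (X Y D E T : Set V) : Prop where
  disjoint : Disjoint D X
  nonempty : E.Nonempty
  subset_left : E ⊆ D
  subset_right : E ⊆ T
  inter_nonempty : (T ∩ X).Nonempty
  biConnected_left : G.BiConnected E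
  biConnected_right : G.BiConnected T
  exists_child_left : ∀ v ∈ D \ Y, ∃ w ∈ D, G.dir v w
  exists_child_right : ∀ v ∈ T \ E, ∃ w ∈ T, G.dir v w

variable {G}

/-- Among the supersets of `E` that belong to `I`, a minimal one is connected by bidirected edges,
and each of its vertices outside `E` has a child in it, provided that `I` is closed under the
removal of childless vertices and under the passage to a part without bidirected edges to the
rest. -/
theorem exists_biConnected_superset [Finite V] (hsymm : ∀ v w, G.bi v w → G.bi w v)
    {I : Set V → Prop} (huniv : I Set.univ)
    (herase : ∀ S v, I S → v ∈ S → (∀ w ∈ S, ¬ G.dir v w) → I (S \ {v}))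
    (hsplit : ∀ S A, I S → A ⊆ S → (∀ v ∈ A, ∀ w ∈ S \ A, ¬ G.bi v w) → I A)
    {E : Set V} (hE : G.BiConnected E) :
    ∃ T, I T ∧ E ⊆ T ∧ G.BiConnected T ∧ ∀ v ∈ T \ E, ∃ w ∈ T, G.dir v w := by
  obtain ⟨T, ⟨hIT, hET⟩, hmin⟩ := (Set.toFinite {T | I T ∧ E ⊆ T}).exists_minimal
    ⟨Set.univ, huniv, Set.subset_univ E⟩
  refine ⟨T, hIT, hET, fun A hAT hA hAne => ?_, fun v hv => ?_⟩
  · by_contra! hno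
    have hno' : ∀ v ∈ T \ A, ∀ w ∈ T \ (T \ A), ¬ G.bi v w := fun v hv w hw h =>
      hno w (by_contra fun hwA => hw.2 ⟨hw.1, hwA⟩) v hv (hsymm _ _ h)
    have hIA := hsplit T A hIT hAT hno
    have hIB := hsplit T (T \ A) hIT Set.sdiff_subset hno'
    by_cases hEA : E ⊆ A
    · exact hAne (hAT.antisymm (hmin ⟨hIA, hEA⟩ hAT))
    by_cases hEB : E ∩ A = ∅
    · have hEB' : E ⊆ T \ A := fun v hv =>
        ⟨hET hv, fun hvA => (Set.eq_empty_iff_forall_notMem.1 hEB v) ⟨hv, hvA⟩⟩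
      obtain ⟨v, hv⟩ := hA
      exact (hmin ⟨hIB, hEB'⟩ Set.sdiff_subset (hAT hv)).2 hv
    · obtain ⟨v, hv, w, hw, h⟩ := hE (E ∩ A) Set.inter_subset_left
        (Set.nonempty_iff_ne_empty.2 hEB) fun e => hEA (Set.inter_eq_left.1 e)
      exact hno v hv.2 w ⟨hET hw.1, fun hwA => hw.2 ⟨hw.1, hwA⟩⟩ h
  · by_contra! hno
    have hI := herase T v hIT hv.1 hno
    have hE' : E ⊆ T \ {v} := fun w hw => ⟨hET hw, fun e => hv.2 (e ▸ hw)⟩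
    exact (hmin ⟨hI, hE'⟩ Set.sdiff_subset hv.1).2 rfl

/-- A set `D` outside `I` has a bidirected component outside `I`, provided that `I` contains the
empty set and is closed under disjoint unions without bidirected edges in between. -/
theorem exists_biConnected_subset [Finite V] {I : Set V → Prop} (hempty : I ∅)
    (hsymm : ∀ v w, G.bi v w → G.bi w v)
    (hunion : ∀ S A, A ⊆ S → (∀ v ∈ A, ∀ w ∈ S \ A, ¬ G.bi v w) → I A → I (S \ A) → I S)
    {D : Set V} (hD : ¬ I D) :
    ∃ E ⊆ D, ¬ I E ∧ E.Nonempty ∧ G.BiConnected E ∧ ∀ v ∈ E, ∀ w ∈ D \ E, ¬ G.bi v w := by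
  obtain ⟨E, ⟨hED, hIE, hsep⟩, hmin⟩ :=
    (Set.toFinite {E | E ⊆ D ∧ ¬ I E ∧ ∀ v ∈ E, ∀ w ∈ D \ E, ¬ G.bi v w}).exists_minimal
      ⟨D, subset_rfl, hD, fun v _ w hw => absurd hw.1 hw.2⟩
  refine ⟨E, hED, hIE, Set.nonempty_iff_ne_empty.2 fun e => hIE (e ▸ hempty),
    fun A hAE hA hAne => ?_, hsep⟩
  by_contra! hno
  have hsub {B : Set V} (hBE : B ⊆ E) (hB : ∀ v ∈ B, ∀ w ∈ E \ B, ¬ G.bi v w) (hBne : B ≠ E) :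
      I B := by
    by_contra hIB
    refine hBne (hBE.antisymm (hmin ⟨hBE.trans hED, hIB, fun v hv w hw => ?_⟩ hBE))
    by_cases hwE : w ∈ E
    · exact hB v hv w ⟨hwE, hw.2⟩
    · exact hsep v (hBE hv) w ⟨hw.1, hwE⟩
  refine hIE (hunion E A hAE hno (hsub hAE hno hAne) (hsub Set.sdiff_subset ?_ ?_))
  · exact fun v hv w hw h =>
      hno w (by_contra fun hwA => hw.2 ⟨hw.1, hwA⟩) v hv (hsymm _ _ h)
  · obtain ⟨v, hv⟩ := hA
    exact fun e => (e.symm.subset (hAE hv)).2 hv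

end MixedGraph

/-- The identification half of the hedge criterion, for models with independent unobserved
variables each of which may appear in any number of functions: if the effect of `X` on `Y` is not
determined by the graph and the observational distribution, then there is a hedge. Here `D` is the
set of the ancestors of `Y` after the removal of `X`, and `E` is a bidirected component of `D` the
c-factor of which is not determined; `T` is a minimal superset of `E` with a
determined c-factor. -/
theorem MixedGraph.exists_isHedge {V : Type} [Finite V] {α : V → Type} [∀ v, Finite (α v)]
    [∀ v, Nonempty (α v)] {G : MixedGraph V} (hG : G.IsSMG) {X Y : Set V} (hXY : Disjoint X Y)
    {M₁ M₂ : CausalModel α} (h₁ : M₁.inducedGraph = G) (h₂ : M₂.inducedGraph = G)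
    (hI₁ : M₁.Independent) (hI₂ : M₂.Independent) (hP : M₂.Positive)
    (hobs : ∀ a, M₁.obs a = M₂.obs a) {x y : ∀ v, α v}
    (hne : M₁.effect X x Y y ≠ M₂.effect X x Y y) :
    ∃ D E T, G.IsHedge X Y D E T := by
  classical
  have (v : V) : Fintype (α v) := Fintype.ofFinite _
  let I : Set V → Prop := fun S => ∀ a, M₁.cFactor S a = M₂.cFactor S a
  let D : Set V := {v | ∃ y ∈ Y, Relation.ReflTransGen (fun a b => G.dir a b ∧ a ∉ X) v y}
  have hDX : Disjoint D X := by
    rw [Set.disjoint_left]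
    rintro v ⟨y, hy, hvy⟩
    rcases hvy.cases_head with rfl | ⟨w, hw, -⟩
    · exact fun hvX => Set.disjoint_left.1 hXY hvX hy
    · exact hw.2
  have hDpa : ∀ v ∈ D, ∀ w, G.dir w v → w ∉ X → w ∈ D := fun v ⟨y, hy, hvy⟩ w hw hwX =>
    ⟨y, hy, .head ⟨hw, hwX⟩ hvy⟩
  have hID : ¬ I D := fun h => hne <| CausalModel.effect_eq_of_cFactor_eq hG.acyclic h₁ h₂ hDX
    (fun y hy => ⟨y, hy, .refl⟩) hDpa h x y
  obtain ⟨E, hED, hIE, hEne, hE, hsep⟩ := exists_biConnected_subset (G := G) (I := I)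
    (fun a => by simp [CausalModel.cFactor_empty]) hG.bi_symm
    (fun S A hAS hA hIA hIB a => by
      rw [← Set.union_sdiff_cancel hAS, M₁.cFactor_union hI₁ Set.disjoint_sdiff_right (h₁ ▸ hA),
        M₂.cFactor_union hI₂ Set.disjoint_sdiff_right (h₂ ▸ hA), hIA a, hIB a]) hID
  obtain ⟨T, hIT, hET, hT, hTc⟩ := exists_biConnected_superset (G := G) (I := I) hG.bi_symm
    (fun a => by simp [CausalModel.cFactor_univ, hobs])
    (fun S v hS hv hc a => by
      rw [← M₁.sum_cFactor_update hv, ← M₂.sum_cFactor_update hv]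
      · simp only [hS _]
      · rw [← h₂] at hc
        exact hc
      · rw [← h₁] at hc
        exact hc)
    (fun S A hS hAS hA => (CausalModel.cFactor_eq_of_union hG.acyclic h₁ h₂ hI₁ hI₂ hP hS A (S \ A)
      (Set.union_sdiff_cancel hAS).symm Set.disjoint_sdiff_right hA
      fun v hv w hw h => hA v hv w hw (hG.bi_symm _ _ h)).1) hE
  have hETne : E ≠ T := fun e => hIE (e ▸ hIT)
  refine ⟨D, E, T, hDX, hEne, hED, hET, ?_, hE, hT, ?_, hTc⟩
  · -- otherwise `T` would consist of ancestors of `Y` outside `X`, and belong to the component `E`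
    by_contra hTX
    have hTD : T ⊆ D := by
      by_contra hTD
      obtain ⟨v, ⟨hvT, hvD⟩, hv⟩ := exists_childless hG.acyclic (Set.sdiff_nonempty.2 hTD)
      obtain ⟨w, hw, hvw⟩ := hTc v ⟨hvT, fun hvE => hvD (hED hvE)⟩
      by_cases hwD : w ∈ D
      · exact hvD (hDpa w hwD v hvw fun hvX => hTX ⟨v, hvT, hvX⟩)
      · exact hv w ⟨hw, hwD⟩ hvw
    obtain ⟨v, hv, w, hw, h⟩ := hT E hET hEne hETne
    exact hsep v hv w ⟨hTD hw.1, hw.2⟩ h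
  · rintro v ⟨⟨y, hy, hvy⟩, hvY⟩
    rcases hvy.cases_head with rfl | ⟨w, hw, hwy⟩
    · exact absurd hy hvY
    · exact ⟨w, ⟨y, hy, hwy⟩, hw.1⟩

/-! ### Random bits -/

section RandomBits

theorem zmod_two_eq_zero_or_one : ∀ x : ZMod 2, x = 0 ∨ x = 1 := by decide

/-- The nontrivial additive character of `ℤ/2`. -/
noncomputable def bitSign (x : ZMod 2) : ℝ := if x = 0 then 1 else -1

@[simp] theorem bitSign_zero : bitSign 0 = 1 := if_pos rfl

@[simp] theorem bitSign_one : bitSign 1 = -1 := if_neg one_ne_zero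

theorem bitSign_add (x y : ZMod 2) : bitSign (x + y) = bitSign x * bitSign y := by
  obtain rfl | rfl := zmod_two_eq_zero_or_one x <;>
    obtain rfl | rfl := zmod_two_eq_zero_or_one y <;> simp [CharTwo.add_self_eq_zero]

theorem bitSign_sum {ι : Type*} (s : Finset ι) (f : ι → ZMod 2) :
    bitSign (∑ i ∈ s, f i) = ∏ i ∈ s, bitSign (f i) := by
  classical
  induction s using Finset.induction_on with
  | empty => simp
  | insert i s hi ih => rw [Finset.sum_insert hi, Finset.prod_insert hi, bitSign_add, ih]

theorem sum_zmod_two {M : Type*} [AddCommMonoid M] (f : ZMod 2 → M) : ∑ x, f x = f 0 + f 1 :=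
  Fin.sum_univ_two f

/-- The distribution of a bit with `E (-1) ^ x = β`. -/
noncomputable def bitWeight (β : unitInterval) (x : ZMod 2) : ℝ := (1 + β * bitSign x) / 2

theorem bitWeight_nonneg (β : unitInterval) (x : ZMod 2) : 0 ≤ bitWeight β x := by
  have h₀ := β.2.1
  have h₁ := β.2.2
  obtain rfl | rfl := zmod_two_eq_zero_or_one x <;> simp [bitWeight] <;> linarith

theorem sum_bitWeight_mul_bitSign (β : unitInterval) (c : ZMod 2) :
    ∑ x, bitWeight β x * bitSign (c * x) = if c = 0 then 1 else (β : ℝ) := by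
  rw [sum_zmod_two]
  obtain rfl | rfl := zmod_two_eq_zero_or_one c
  · simp [bitWeight]
    ring
  · simp [bitWeight]
    ring

open MeasureTheory

/-- The distribution of a bit with `E (-1) ^ x = β`, as a measure. -/
noncomputable def bitMeasure (β : unitInterval) : Measure (ZMod 2) :=
  ∑ x, ENNReal.ofReal (bitWeight β x) • Measure.dirac x

theorem bitMeasure_singleton (β : unitInterval) (x : ZMod 2) :
    bitMeasure β {x} = ENNReal.ofReal (bitWeight β x) := by
  obtain rfl | rfl := zmod_two_eq_zero_or_one x <;> simp [bitMeasure, sum_zmod_two]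

instance (β : unitInterval) : IsProbabilityMeasure (bitMeasure β) where
  measure_univ := by
    have h := sum_bitWeight_mul_bitSign β 0
    simp only [zero_mul, bitSign_zero, mul_one, if_true] at h
    simp only [bitMeasure, Measure.coe_finsetSum, Finset.sum_apply, Measure.smul_apply,
      measure_univ, smul_eq_mul, mul_one]
    rw [← ENNReal.ofReal_sum_of_nonneg fun x _ => bitWeight_nonneg β x, h, ENNReal.ofReal_one]

variable {ι : Type*} [Fintype ι]

theorem measureReal_pi_bitMeasure [DecidableEq ι] (β : ι → unitInterval) (A : Set (ι → ZMod 2))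
    [DecidablePred (· ∈ A)] :
    (Measure.pi fun i => bitMeasure (β i)).real A =
      ∑ u, if u ∈ A then ∏ i, bitWeight (β i) (u i) else 0 := by
  have (u : ι → ZMod 2) : (Measure.pi fun i => bitMeasure (β i)).real {u} =
      ∏ i, bitWeight (β i) (u i) := by
    rw [Measure.real, Measure.pi_singleton]
    simp only [bitMeasure_singleton]
    rw [ENNReal.toReal_prod]
    exact Finset.prod_congr rfl fun i _ => ENNReal.toReal_ofReal (bitWeight_nonneg _ _)
  rw [← Finset.sum_filter]
  simp only [← this]
  rw [sum_measureReal_singleton]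
  congr 1
  ext
  simp

/-- The characteristic function of independent bits. -/
theorem sum_prod_bitWeight_mul_bitSign [DecidableEq ι] (β : ι → unitInterval) (c : ι → ZMod 2) :
    ∑ u : ι → ZMod 2, (∏ i, bitWeight (β i) (u i)) * bitSign (∑ i, c i * u i) =
      ∏ i, if c i = 0 then 1 else (β i : ℝ) := by
  simp only [← sum_bitWeight_mul_bitSign, Fintype.prod_sum, bitSign_sum, Finset.prod_mul_distrib]

/-- Fourier inversion: the probability that fair bits `k` satisfy the linear equations `A k = t`
is the average of the character `χ ↦ (-1) ^ χ(t)` over the linear forms `χ` that annihilate the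
image of `A`. -/
theorem sum_prod_bitWeight_linear [DecidableEq ι] {V : Type*} [Fintype V]
    [DecidableEq V] (A : V → ι → ZMod 2) (t : V → ZMod 2) :
    (∑ k : ι → ZMod 2, if ∀ v, ∑ i, A v i * k i = t v then ∏ i, bitWeight 0 (k i) else 0) *
      2 ^ Fintype.card V =
      ∑ χ : V → ZMod 2, if ∀ i, ∑ v, χ v * A v i = 0 then bitSign (∑ v, χ v * t v) else 0 := by
  have h₁ (z : V → ZMod 2) : ∑ χ : V → ZMod 2, bitSign (∑ v, χ v * z v) =
      if ∀ v, z v = 0 then 2 ^ Fintype.card V else 0 := by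
    have (x : ZMod 2) : ∑ c, bitSign (c * x) = if x = 0 then (2 : ℝ) else 0 := by
      rw [sum_zmod_two]
      obtain rfl | rfl := zmod_two_eq_zero_or_one x <;> simp
      norm_num
    simp only [bitSign_sum]
    rw [← Fintype.prod_sum fun v c => bitSign (c * z v)]
    simp only [this]
    split_ifs with h
    · simp [h]
    · obtain ⟨v, hv⟩ := not_forall.1 h
      exact Finset.prod_eq_zero (Finset.mem_univ v) (if_neg hv)
  have h₂ (k : ι → ZMod 2) :
      (if ∀ v, ∑ i, A v i * k i = t v then ∏ i, bitWeight 0 (k i) else 0) *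
        2 ^ Fintype.card V = ∑ χ : V → ZMod 2, bitSign (∑ v, χ v * t v) *
          ((∏ i, bitWeight 0 (k i)) * bitSign (∑ i, (∑ v, χ v * A v i) * k i)) := by
    have h₃ (χ : V → ZMod 2) : ∑ v, χ v * (∑ i, A v i * k i + t v) =
        ∑ v, χ v * t v + ∑ i, (∑ v, χ v * A v i) * k i := by
      simp only [mul_add, Finset.sum_add_distrib, Finset.mul_sum, Finset.sum_mul]
      rw [Finset.sum_comm, add_comm]
      simp only [mul_assoc]
    have h₄ := h₁ fun v => ∑ i, A v i * k i + t v
    simp only [h₃, bitSign_add, CharTwo.add_eq_zero] at h₄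
    simp only [mul_left_comm (bitSign _), ← Finset.mul_sum]
    rw [h₄]
    split_ifs <;> simp
  rw [Finset.sum_mul]
  simp only [h₂]
  rw [Finset.sum_comm]
  refine Finset.sum_congr rfl fun χ _ => ?_
  rw [← Finset.mul_sum, sum_prod_bitWeight_mul_bitSign]
  split_ifs with h
  · simp [h]
  · obtain ⟨i, hi⟩ := not_forall.1 h
    rw [Finset.prod_eq_zero (Finset.mem_univ i), mul_zero]
    simp [hi]

end RandomBits

/-! ### The models on a hedge -/

open MeasureTheory

/-- The noise of the parity models: a fair bit for each pair of vertices, which is of use only if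
the pair is a bidirected edge; a fair bit for each vertex; and two biased bits for each vertex. A
bidirected edge has two fair bits, one for each order of its endpoints. -/
abbrev ParityNoise (V : Type) : Type := ((V × V) ⊕ V) ⊕ (V ⊕ V)

/-- The data of a parity model: sets `E ⊆ S` and `E ⊆ D` of vertices of a semi-Markovian graph,
a child `next v` in `S` of each vertex `v` of `S \ E`, and a child `carry v` in `D` of each
vertex `v` of `D \ Y`. -/
structure ParityScheme {V : Type} (G : MixedGraph V) (Y D E S : Set V) where
  next : V → V
  carry : V → V
  isSMG : G.IsSMG
  subset_left : E ⊆ D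
  subset_right : E ⊆ S
  next_mem : ∀ v ∈ S \ E, next v ∈ S
  dir_next : ∀ v ∈ S \ E, G.dir v (next v)
  carry_mem : ∀ v ∈ D \ Y, carry v ∈ D
  dir_carry : ∀ v ∈ D \ Y, G.dir v (carry v)

namespace ParityScheme

variable {V : Type} [Fintype V] {G : MixedGraph V} {Y D E S : Set V} (p : ParityScheme G Y D E S)

/-- The bias of the noise bits. -/
noncomputable def bias : ParityNoise V → unitInterval :=
  Sum.elim (fun _ => 0) fun _ => ⟨1 / 2, by norm_num, by norm_num⟩

open Classical in
/-- The coefficients of the fair bits in the first bit of `v`: it involves those of the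
bidirected edges at `v` within `S`, and that of `v` itself if `v` does not belong to `S`. -/
noncomputable def incidence (G : MixedGraph V) (S : Set V) (v : V) : (V × V) ⊕ V → ZMod 2 :=
  Sum.elim (fun q => if q.1 ∈ S ∧ q.2 ∈ S ∧ G.bi q.1 q.2 then
    (if q.1 = v then 1 else 0) + (if q.2 = v then 1 else 0) else 0)
    fun w => if w = v ∧ v ∉ S then 1 else 0

open Classical in
/-- The first bit of `v`: the sum of the first bits of the vertices that point to `v` via `next`,
of fair bits, and of a biased bit if `v` belongs to `E`. -/
noncomputable def firstBit (v : V) (a : V → ZMod 2 × ZMod 2) (u : ParityNoise V → ZMod 2) :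
    ZMod 2 :=
  ∑ w with w ∈ S \ E ∧ p.next w = v, (a w).1 +
    (∑ j, incidence G S v j * u (.inl j) + if v ∈ E then u (.inr (.inl v)) else 0)

open Classical in
/-- What is added to the first bit of `v ∈ E` in order to obtain the second bit: the sum of the
second bits of the vertices that point to `v` via `carry`, and a biased bit. -/
noncomputable def carryBit (v : V) (a : V → ZMod 2 × ZMod 2) (u : ParityNoise V → ZMod 2) :
    ZMod 2 :=
  ∑ w with w ∈ D \ Y ∧ p.carry w = v, (a w).2 + u (.inr (.inr v))

/-- The noise bits that are declared as arguments of the function of `v`. -/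
def noiseArgs (G : MixedGraph V) (v : V) : ParityNoise V → Prop :=
  Sum.elim (Sum.elim (fun q => G.bi q.1 q.2 ∧ (v = q.1 ∨ v = q.2)) (v = ·))
    (Sum.elim (v = ·) (v = ·))

open Classical in
/-- The parity model. Each vertex carries two bits. The first bits flow from `S \ E` to `E`; as the
bits of each bidirected edge within `S` are counted twice, the sum of the first bits over `E` does
not depend on them, unless an intervention interrupts the flow. The second bits carry the
sum of the first bits over `E` down to `Y`. The biased bits ensure that the observational
distribution is strictly positive. -/
noncomputable def model : CausalModel (fun _ : V => ZMod 2 × ZMod 2) where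
  U := ParityNoise V
  dom _ := ZMod 2
  P := Measure.pi fun i => bitMeasure (bias i)
  pa v := {w | G.dir w v}
  upa v := {i | noiseArgs G v i}
  f v a u := (p.firstBit v a u, (if v ∈ E then p.firstBit v a u else 0) + p.carryBit v a u)
  self_notMem_pa v h := p.isSMG.acyclic v (.single h)
  f_congr v a a' u u' ha hu := by
    have h₁ : p.firstBit v a u = p.firstBit v a' u' := by
      unfold firstBit
      congr 1
      · refine Finset.sum_congr rfl fun w hw => ?_
        obtain ⟨-, hw', rfl⟩ := Finset.mem_filter.1 hw
        rw [ha w (p.dir_next w hw')]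
      · rw [hu (.inr (.inl v)) rfl]
        congr 1
        refine Finset.sum_congr rfl fun j _ => ?_
        rcases j with q | w
        · by_cases h : G.bi q.1 q.2 ∧ (v = q.1 ∨ v = q.2)
          · rw [hu _ h]
          · suffices incidence G S v (.inl q) = 0 by rw [this, zero_mul, zero_mul]
            simp only [incidence, Sum.elim_inl]
            split_ifs with h₁ h₂ h₃ h₃ <;> grind
        · by_cases h : v = w
          · rw [hu (.inl (.inr w)) h]
          · simp [incidence, Ne.symm h]
    have h₂ : p.carryBit v a u = p.carryBit v a' u' := by
      unfold carryBit
      rw [hu (.inr (.inr v)) rfl]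
      congr 1
      refine Finset.sum_congr rfl fun w hw => ?_
      obtain ⟨-, hw', rfl⟩ := Finset.mem_filter.1 hw
      rw [ha w (p.dir_carry w hw')]
    rw [h₁, h₂]
  measurableSet_f _ _ _ := MeasurableSet.of_discrete

theorem inducedGraph_model : p.model.inducedGraph = G := by
  ext v w
  · rfl
  · constructor
    · rintro ⟨hvw, i, hv, hw⟩
      change noiseArgs G v i at hv
      change noiseArgs G w i at hw
      rcases i with (q | x) | (x | x)
      · obtain ⟨h, rfl | rfl⟩ := hv <;> obtain ⟨-, rfl | rfl⟩ := hw
        · exact absurd rfl hvw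
        · exact h
        · exact p.isSMG.bi_symm _ _ h
        · exact absurd rfl hvw
      all_goals exact absurd (Eq.trans hv (Eq.symm hw)) hvw
    · intro h
      exact ⟨fun e => p.isSMG.bi_irrefl v (by rwa [← e] at h), .inl (.inl (v, w)),
        ⟨h, .inl rfl⟩, ⟨h, .inr rfl⟩⟩

theorem isSemiMarkovian_model : p.model.IsSemiMarkovian where
  independent := ProbabilityTheory.iIndepFun_pi (μ := fun i => bitMeasure (bias i))
    (X := fun _ => id) fun _ => aemeasurable_id
  encard_le_two i := by
    rcases i with (q | x) | (x | x)
    · refine (Set.encard_le_encard (t := {q.1, q.2}) fun v h => h.2).trans ?_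
      refine (Set.encard_insert_le _ _).trans ?_
      rw [Set.encard_singleton, one_add_one_eq_two]
    all_goals
      refine (Set.encard_le_encard (t := {x}) fun v h => h).trans ?_
      rw [Set.encard_singleton]
      exact one_le_two
  acyclic := by
    rw [inducedGraph_model]
    exact p.isSMG.acyclic

/-- If the values `b` flow along `next`, then the sum over a set `A` of vertices is the sum of the
sources in `A` and of the values that flow into `A`. -/
theorem sum_flow [DecidableEq V] {A B : Set V} [DecidablePred (· ∈ A)] [DecidablePred (· ∈ B)]
    (next : V → V) (b s : V → ZMod 2)
    (h : ∀ v ∈ A, b v = ∑ w with w ∈ B ∧ next w = v, b w + s v) :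
    ∑ v with v ∈ A, b v = ∑ w with w ∈ B ∧ next w ∈ A, b w + ∑ v with v ∈ A, s v := by
  rw [Finset.sum_congr rfl fun v hv => h v (Finset.mem_filter.1 hv).2, Finset.sum_add_distrib]
  congr 1
  rw [← Finset.sum_fiberwise_of_maps_to (s := {w | w ∈ B ∧ next w ∈ A}) (g := next)
    (t := {v | v ∈ A}) (by simp)]
  refine Finset.sum_congr rfl fun v hv => Finset.sum_congr ?_ fun _ _ => rfl
  ext w
  have := (Finset.mem_filter.1 hv).2
  simp only [Finset.mem_filter, Finset.mem_univ, true_and]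
  constructor
  · rintro ⟨h, rfl⟩
    exact ⟨⟨h, this⟩, rfl⟩
  · exact fun h => ⟨h.1.1, h.2⟩

open Classical in
/-- As `S` is connected by bidirected edges, the sum over `S` is the only nonzero linear form that
annihilates the contribution of each fair bit to the first bits. -/
theorem annihilator_incidence (hS : G.BiConnected S) (χ : V → ZMod 2) :
    (∀ j, ∑ v, χ v * incidence G S v j = 0) ↔
      χ = 0 ∨ χ = fun v => if v ∈ S then 1 else 0 := by
  have h₁ (q : V × V) : ∑ v, χ v * incidence G S v (.inl q) =
      if q.1 ∈ S ∧ q.2 ∈ S ∧ G.bi q.1 q.2 then χ q.1 + χ q.2 else 0 := by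
    simp only [incidence, Sum.elim_inl]
    split_ifs
    · simp [mul_add, Finset.sum_add_distrib]
    · simp
  have h₂ (w : V) : ∑ v, χ v * incidence G S v (.inr w) = if w ∈ S then 0 else χ w := by
    simp only [incidence, Sum.elim_inr]
    rw [Finset.sum_eq_single w]
    · split_ifs <;> simp_all
    · intro v _ hv
      simp [hv.symm]
    · simp
  simp only [Sum.forall, h₁, h₂]
  constructor
  · rintro ⟨hb, hk⟩
    by_cases hA : {v ∈ S | χ v = 1} = S
    · right
      ext v
      split_ifs with hv
      · rw [← hA] at hv
        exact hv.2
      · simpa [hv] using hk v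
    · left
      have hA' : {v ∈ S | χ v = 1} = ∅ := by
        by_contra hne
        obtain ⟨v, hv, w, hw, h⟩ := hS _ (Set.sep_subset _ _) (Set.nonempty_iff_ne_empty.2 hne) hA
        have := hb (v, w)
        rw [if_pos ⟨hv.1, hw.1, h⟩, CharTwo.add_eq_zero] at this
        exact hw.2 ⟨hw.1, this ▸ hv.2⟩
      ext v
      by_cases hv : v ∈ S
      · refine (zmod_two_eq_zero_or_one _).resolve_right fun h => ?_
        exact Set.eq_empty_iff_forall_notMem.1 hA' v ⟨hv, h⟩
      · simpa [hv] using hk v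
  · rintro (rfl | rfl)
    · simp
    · constructor
      · intro q
        split_ifs with h
        · simp [h, CharTwo.add_self_eq_zero]
        · rfl
      · intro w
        split_ifs with h
        · rfl
        · exact if_neg h

end ParityScheme

theorem CausalModel.sum_mul_marginal {V : Type} [Finite V] {α : V → Type} [∀ v, Finite (α v)]
    [∀ v, Nonempty (α v)] (M : CausalModel α)
    (h : ∀ v, ¬ Relation.TransGen M.inducedGraph.dir v v) (Y : Set V)
    [Fintype (∀ v : Y, α v)] [Fintype (∀ v, α v)] (φ : (∀ v : Y, α v) → ℝ) :
    ∑ b, φ b * M.marginal Y b = ∑ a : ∀ v, α v, φ (fun v => a v) * M.obs a := by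
  classical
  rw [← Finset.sum_fiberwise_of_maps_to (s := Finset.univ) (t := Finset.univ)
    (g := fun (a : ∀ v, α v) (v : Y) => a v) (by simp)]
  refine Finset.sum_congr rfl fun b _ => ?_
  rw [marginal, prob_eq_sum_obs _ h, Finset.mul_sum]
  refine Finset.sum_congr ?_ fun a ha => ?_
  · ext a
    simp [funext_iff]
  · have ha := (Finset.mem_filter.1 ha).2
    simp [← ha]

namespace ParityScheme

variable {V : Type} [Fintype V] {G : MixedGraph V} {Y D E S : Set V} (p : ParityScheme G Y D E S)

open Classical in
theorem obs_intervene_model (X : Set V) (x a : V → ZMod 2 × ZMod 2) :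
    (p.model.intervene X x).obs a = ∑ u : ParityNoise V → ZMod 2,
      if (p.model.intervene X x).IsSolution u a then ∏ i, bitWeight (bias i) (u i) else 0 := by
  refine Eq.trans ?_ (measureReal_pi_bitMeasure bias
    {u | (p.model.intervene X x).IsSolution u a})
  change (p.model.intervene X x).P.real _ = (p.model.intervene X x).P.real _
  congr 1
  ext u
  simp only [Set.mem_singleton_iff, exists_eq_left]
  rfl

open Classical in
theorem obs_model_eq_sum (a : V → ZMod 2 × ZMod 2) :
    p.model.obs a = ∑ u : ParityNoise V → ZMod 2,
      if p.model.IsSolution u a then ∏ i, bitWeight (bias i) (u i) else 0 := by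
  refine Eq.trans ?_ (measureReal_pi_bitMeasure bias {u | p.model.IsSolution u a})
  change p.model.P.real _ = p.model.P.real _
  congr 1
  ext u
  simp only [Set.mem_singleton_iff, exists_eq_left]
  rfl

open Classical in
theorem isSolution_model {u : ParityNoise V → ZMod 2} {a : V → ZMod 2 × ZMod 2} :
    p.model.IsSolution u a ↔ ∀ v, (a v).1 = p.firstBit v a u ∧
      (a v).2 = (if v ∈ E then (a v).1 else 0) + p.carryBit v a u := by
  refine forall_congr' fun v => Prod.ext_iff.trans ?_
  change (a v).1 = p.firstBit v a u ∧
    (a v).2 = (if v ∈ E then p.firstBit v a u else 0) + p.carryBit v a u ↔ _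
  constructor <;>
  · rintro ⟨h₁, h₂⟩
    exact ⟨h₁, by simpa only [← h₁] using h₂⟩

open Classical in
/-- The observational distribution of a parity model, in a form that does not depend on `S`. -/
theorem obs_model (hE : E.Nonempty) (hS : G.BiConnected S) (a : V → ZMod 2 × ZMod 2) :
    p.model.obs a * 2 ^ Fintype.card V = ∑ ρ : V ⊕ V → ZMod 2,
      if ∀ v, (a v).2 = (if v ∈ E then (a v).1 else 0) +
        (∑ w with w ∈ D \ Y ∧ p.carry w = v, (a w).2 + ρ (.inr v)) then
        (∏ i, bitWeight ⟨1 / 2, by norm_num, by norm_num⟩ (ρ i)) *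
          (1 + bitSign (∑ v with v ∈ E, ((a v).1 + ρ (.inl v)))) else 0 := by
  rw [obs_model_eq_sum, ← (Equiv.sumArrowEquivProdArrow _ _ _).symm.sum_comp,
    Fintype.sum_prod_type_right, Finset.sum_mul]
  refine Finset.sum_congr rfl fun ρ _ => ?_
  -- the values that the fair bits have to sum up to if the model yields `a`
  let t : V → ZMod 2 := fun v => (a v).1 + (∑ w with w ∈ S \ E ∧ p.next w = v, (a w).1 +
    if v ∈ E then ρ (.inl v) else 0)
  -- the flow from `S \ E` to `E` cancels in the sum over `S`
  have ht : ∑ v with v ∈ S, t v = ∑ v with v ∈ E, ((a v).1 + ρ (.inl v)) := by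
    have h₁ := sum_flow (A := S) (B := S \ E) p.next (fun v => (a v).1)
      (fun v => (t v) + if v ∈ E then ρ (.inl v) else 0) fun v _ => by
        simp only [t]
        generalize (if v ∈ E then ρ (.inl v) else 0) = r
        generalize (∑ w with w ∈ S \ E ∧ p.next w = v, (a w).1) = s
        linear_combination (-s - r) * CharTwo.two_eq_zero (R := ZMod 2)
    have h₂ : ∑ v with v ∈ S, (a v).1 =
        ∑ v with v ∈ S \ E ∧ p.next v ∈ S, (a v).1 + ∑ v with v ∈ E, (a v).1 := by
      rw [← Finset.sum_filter_not_add_sum_filter _ (· ∈ E), Finset.filter_filter,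
        Finset.filter_filter]
      congr 1
      · refine Finset.sum_congr ?_ fun _ _ => rfl
        ext v
        simp only [Finset.mem_filter, Finset.mem_univ, true_and]
        exact ⟨fun h => ⟨h, p.next_mem v h⟩, fun h => h.1⟩
      · refine Finset.sum_congr ?_ fun _ _ => rfl
        ext v
        simpa using @p.subset_right v
    have h₃ : ∑ v with v ∈ S, (if v ∈ E then ρ (.inl v) else 0) =
        ∑ v with v ∈ E, ρ (.inl v) := by
      rw [← Finset.sum_filter, Finset.filter_filter]
      refine Finset.sum_congr ?_ fun _ _ => rfl
      ext v
      simpa using @p.subset_right v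
    rw [Finset.sum_add_distrib, h₃] at h₁
    rw [h₂] at h₁
    have h₄ := add_left_cancel h₁
    have h₅ : ∑ v with v ∈ E, ((a v).1 + ρ (.inl v)) =
      ∑ v with v ∈ E, (a v).1 + ∑ v with v ∈ E, ρ (.inl v) := Finset.sum_add_distrib
    rw [h₅, h₄, add_assoc, CharTwo.add_self_eq_zero, add_zero]
  have hsol (k : (V × V) ⊕ V → ZMod 2) :
      p.model.IsSolution (Sum.elim k ρ) a ↔
        (∀ v, ∑ j, incidence G S v j * k j = t v) ∧
          ∀ v, (a v).2 = (if v ∈ E then (a v).1 else 0) +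
            (∑ w with w ∈ D \ Y ∧ p.carry w = v, (a w).2 + ρ (.inr v)) := by
    refine p.isSolution_model.trans (forall_and.trans ?_)
    refine and_congr (forall_congr' fun v => ?_) Iff.rfl
    change (a v).1 = ∑ w with w ∈ S \ E ∧ p.next w = v, (a w).1 +
      (∑ j, incidence G S v j * k j + if v ∈ E then ρ (.inl v) else 0) ↔
      _ = (a v).1 + (∑ w with w ∈ S \ E ∧ p.next w = v, (a w).1 +
        if v ∈ E then ρ (.inl v) else 0)
    generalize (if v ∈ E then ρ (.inl v) else 0) = r
    generalize (∑ w with w ∈ S \ E ∧ p.next w = v, (a w).1) = s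
    generalize ∑ j, incidence G S v j * k j = i
    generalize (a v).1 = b
    revert r s i b
    decide
  have hsum : (∑ k : (V × V) ⊕ V → ZMod 2, if ∀ v, ∑ j, incidence G S v j * k j = t v then
      ∏ j, bitWeight 0 (k j) else 0) * 2 ^ Fintype.card V = 1 + bitSign (∑ v with v ∈ S, t v) := by
    have hne : (0 : V → ZMod 2) ≠ fun v => if v ∈ S then 1 else 0 := by
      obtain ⟨v, hv⟩ := hE
      intro h
      simpa [p.subset_right hv] using congrFun h v
    rw [sum_prod_bitWeight_linear]
    simp only [annihilator_incidence hS]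
    rw [← Finset.sum_filter]
    have : ({χ : V → ZMod 2 | χ = 0 ∨ χ = fun v => if v ∈ S then 1 else 0} : Finset _) =
        {0, fun v => if v ∈ S then 1 else 0} := by
      ext χ
      simp
    rw [this, Finset.sum_pair hne]
    simp [Finset.sum_filter]
  have hprod (k : (V × V) ⊕ V → ZMod 2) :
      ∏ i, bitWeight (bias i) ((Sum.elim k ρ : ParityNoise V → ZMod 2) i) =
        (∏ i, bitWeight ⟨1 / 2, by norm_num, by norm_num⟩ (ρ i)) *
          ∏ j, bitWeight 0 (k j) := by
    rw [Fintype.prod_sum_type, mul_comm]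
    rfl
  change (∑ k : (V × V) ⊕ V → ZMod 2, if p.model.IsSolution (Sum.elim k ρ) a then
    ∏ i, bitWeight (bias i) ((Sum.elim k ρ : ParityNoise V → ZMod 2) i) else 0) * _ = _
  split_ifs with h
  · have hsol' (k) := (hsol k).trans (and_iff_left h)
    simp only [hsol', hprod]
    rw [← ht, ← hsum, ← mul_assoc, Finset.mul_sum]
    simp only [mul_ite, mul_zero]
  · rw [Finset.sum_eq_zero fun k _ => if_neg fun hk => h ((hsol k).1 hk).2, zero_mul]

theorem positive_model (hE : E.Nonempty) (hS : G.BiConnected S) : p.model.Positive := by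
  classical
  intro a
  refine pos_of_mul_pos_left ?_ (pow_nonneg zero_le_two (Fintype.card V))
  rw [p.obs_model hE hS]
  have hw (x : ZMod 2) : 0 < bitWeight ⟨1 / 2, by norm_num, by norm_num⟩ x := by
    obtain rfl | rfl := zmod_two_eq_zero_or_one x <;> norm_num [bitWeight]
  have hs (x : ZMod 2) : 0 ≤ 1 + bitSign x := by
    obtain rfl | rfl := zmod_two_eq_zero_or_one x <;> norm_num
  refine Finset.sum_pos' (fun ρ _ => ?_) ⟨Sum.elim (fun v => (a v).1) fun v => (a v).2 +
    ((if v ∈ E then (a v).1 else 0) + ∑ w with w ∈ D \ Y ∧ p.carry w = v, (a w).2),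
    Finset.mem_univ _, ?_⟩
  · split_ifs
    · exact mul_nonneg (Finset.prod_nonneg fun _ _ => (hw _).le) (hs _)
    · rfl
  · rw [if_pos]
    · refine mul_pos (Finset.prod_pos fun _ _ => hw _) ?_
      simp [CharTwo.add_self_eq_zero]
    · intro v
      simp only [Sum.elim_inr]
      generalize (if v ∈ E then (a v).1 else 0) = r
      generalize (∑ w with w ∈ D \ Y ∧ p.carry w = v, (a w).2) = s
      generalize (a v).2 = b
      revert r s b
      decide

open Classical in
/-- The coefficients of the noise bits in the sum of the second bits over `D ∩ Y` after an
intervention, if `A` is the set of the vertices of `S` the first bits of which reach `E`. -/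
noncomputable def contribution (G : MixedGraph V) (D E S A : Set V) : ParityNoise V → ZMod 2 :=
  Sum.elim (fun j => ∑ v with v ∈ A, incidence G S v j)
    (Sum.elim (fun v => if v ∈ E then 1 else 0) (fun v => if v ∈ D then 1 else 0))

open Classical in
/-- The intervention sets the variables in `X` to zero, so that the first bits of the vertices of
`S \ A` do not flow into `A`. -/
theorem sum_carry_eq {X A : Set V} (hDX : Disjoint D X) (hAX : Disjoint A X) (hEA : E ⊆ A)
    (hAS : A ⊆ S) (hout : ∀ v ∈ A \ E, p.next v ∈ A)
    (hin : ∀ v ∈ S \ E, v ∉ X → p.next v ∈ A → v ∈ A) {u : ParityNoise V → ZMod 2}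
    {a : V → ZMod 2 × ZMod 2} (h : (p.model.intervene X fun _ => 0).IsSolution u a) :
    ∑ v with v ∈ D ∩ Y, (a v).2 = ∑ i, contribution G D E S A i * u i := by
  obtain ⟨hX, hf⟩ := (CausalModel.isSolution_intervene _).1 h
  have hb (v) (hv : v ∉ X) : (a v).1 = p.firstBit v a u := congrArg Prod.fst (hf v hv)
  have hg (v) (hv : v ∉ X) : (a v).2 = (if v ∈ E then (a v).1 else 0) + p.carryBit v a u := by
    rw [hb v hv]
    exact congrArg Prod.snd (hf v hv)
  have h₁ := sum_flow (A := D) (B := D \ Y) p.carry (fun v => (a v).2)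
    (fun v => (if v ∈ E then (a v).1 else 0) + u (.inr (.inr v))) fun v hv => by
      simp only [hg v (Set.disjoint_left.1 hDX hv), carryBit]
      ring
  have h₂ := sum_flow (A := A) (B := S \ E) p.next (fun v => (a v).1) _
    fun v hv => hb v (Set.disjoint_left.1 hAX hv)
  have h₃ : ∑ v with v ∈ D, (a v).2 =
      ∑ v with v ∈ D \ Y ∧ p.carry v ∈ D, (a v).2 + ∑ v with v ∈ D ∩ Y, (a v).2 := by
    rw [← Finset.sum_filter_not_add_sum_filter _ (· ∈ Y), Finset.filter_filter,
      Finset.filter_filter]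
    congr 1
    refine Finset.sum_congr ?_ fun _ _ => rfl
    ext v
    simp only [Finset.mem_filter, Finset.mem_univ, true_and]
    exact ⟨fun h => ⟨h, p.carry_mem v h⟩, fun h => h.1⟩
  have h₄ : ∑ v with v ∈ A, (a v).1 =
      ∑ v with v ∈ S \ E ∧ p.next v ∈ A, (a v).1 + ∑ v with v ∈ E, (a v).1 := by
    rw [← Finset.sum_filter_not_add_sum_filter _ (· ∈ E), Finset.filter_filter,
      Finset.filter_filter]
    congr 1
    · refine Finset.sum_subset ?_ ?_
      · intro v
        simp only [Finset.mem_filter, Finset.mem_univ, true_and]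
        exact fun h => ⟨⟨hAS h.1, h.2⟩, hout v h⟩
      · intro v
        simp only [Finset.mem_filter, Finset.mem_univ, true_and]
        intro h h'
        by_cases hvX : v ∈ X
        · rw [hX v hvX, Prod.fst_zero]
        · exact absurd ⟨hin v h.1 hvX h.2, h.1.2⟩ h'
    · refine Finset.sum_congr ?_ fun _ _ => rfl
      ext v
      simpa using @hEA v
  have hsub {B C : Set V} (hBC : B ⊆ C) (φ : V → ZMod 2) :
      ∑ v with v ∈ C, (if v ∈ B then φ v else 0) = ∑ v with v ∈ B, φ v := by
    rw [← Finset.sum_filter, Finset.filter_filter]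
    refine Finset.sum_congr ?_ fun _ _ => rfl
    ext v
    simpa using @hBC v
  rw [h₃, Finset.sum_add_distrib, hsub p.subset_left] at h₁
  rw [h₄, Finset.sum_add_distrib, hsub hEA] at h₂
  rw [add_left_cancel h₁, add_left_cancel h₂]
  simp only [contribution, Fintype.sum_sum_type, Sum.elim_inl, Sum.elim_inr, ite_mul, one_mul,
    zero_mul, Finset.sum_mul, ← Finset.sum_filter, Finset.sum_add_distrib]
  rw [Finset.sum_comm (s := {v | v ∈ A})]
  simp only [add_assoc]
  congr 2
  exact Finset.sum_comm

open Classical in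
/-- The bias of the sum of the second bits over `D ∩ Y` after the intervention, as computed from the
causal effect of `X` on `Y`. -/
theorem sum_bitSign_mul_effect {X A : Set V} (hDX : Disjoint D X) (hAX : Disjoint A X)
    (hEA : E ⊆ A) (hAS : A ⊆ S) (hout : ∀ v ∈ A \ E, p.next v ∈ A)
    (hin : ∀ v ∈ S \ E, v ∉ X → p.next v ∈ A → v ∈ A) :
    ∑ b : Y → ZMod 2 × ZMod 2,
      bitSign (∑ v with v ∈ D ∩ Y, if hv : v ∈ Y then (b ⟨v, hv⟩).2 else 0) *
        p.model.effect X (fun _ => 0) Y (fun v => if hv : v ∈ Y then b ⟨v, hv⟩ else 0) =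
      ∏ i, if contribution G D E S A i = 0 then 1 else (bias i : ℝ) := by
  have hacyc := p.model.intervene_acyclic p.isSemiMarkovian_model.acyclic X fun _ => 0
  simp only [CausalModel.effect, Subtype.coe_prop, dite_true, Subtype.coe_eta]
  rw [CausalModel.sum_mul_marginal _ hacyc Y (fun b : Y → ZMod 2 × ZMod 2 =>
    bitSign (∑ v with v ∈ D ∩ Y, if hv : v ∈ Y then (b ⟨v, hv⟩).2 else 0))]
  have h₁ (a : V → ZMod 2 × ZMod 2) :
      (∑ v with v ∈ D ∩ Y, if _ : v ∈ Y then (a v).2 else 0) = ∑ v with v ∈ D ∩ Y, (a v).2 :=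
    Finset.sum_congr rfl fun v hv => dif_pos (Finset.mem_filter.1 hv).2.2
  simp only [h₁, obs_intervene_model, Finset.mul_sum]
  rw [Finset.sum_comm, ← sum_prod_bitWeight_mul_bitSign]
  refine Finset.sum_congr rfl fun u _ => ?_
  obtain ⟨a, ha, hau⟩ := CausalModel.existsUnique_isSolution _ hacyc u
  rw [Finset.sum_eq_single a, if_pos ha, p.sum_carry_eq hDX hAX hEA hAS hout hin ha, mul_comm]
  · intro b _ hb
    rw [if_neg fun h => hb (hau b h), mul_zero]
  · simp

end ParityScheme

open Classical in
/-- The fair bits cancel in the sum over `A` if and only if `A` is all of `S`: otherwise there is a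
bidirected edge between `A` and `S \ A`. -/
theorem ParityScheme.contribution_inl_eq_zero_iff {V : Type} [Fintype V] {G : MixedGraph V}
    {D E S A : Set V} (hS : G.BiConnected S) (hA : A.Nonempty) :
    (∀ j, contribution G D E S A (.inl j) = 0) ↔ A = S := by
  have h := annihilator_incidence hS fun v => if v ∈ A then 1 else 0
  simp only [ite_mul, one_mul, zero_mul, ← Finset.sum_filter] at h
  refine h.trans ⟨?_, ?_⟩
  · rintro (h | h)
    · obtain ⟨v, hv⟩ := hA
      simpa [hv] using congrFun h v
    · ext v
      have := congrFun h v
      by_cases hv : v ∈ A <;> by_cases hv' : v ∈ S <;> simp_all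
  · rintro rfl
    exact .inr rfl

/-- The other half of the hedge criterion. The parity models with `S = T` and with `S = E` have the
same observational distribution. After an intervention on `X`, the sum of the second bits over `Y`
is biased in the latter. In the former, however, the bits that start in a part of `T` do not reach
`E`, and the fair bit of a bidirected edge between this part and the rest makes the sum fair. -/
theorem MixedGraph.IsHedge.not_identifiable {V : Type} [Finite V] {G : MixedGraph V}
    (hG : G.IsSMG) {X Y D E T : Set V} (h : G.IsHedge X Y D E T) : ¬ Identifiable G X Y := by
  classical
  intro hid
  have := Fintype.ofFinite V
  have : Nonempty V := h.nonempty.to_type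
  obtain ⟨carry, hcarry⟩ : ∃ carry : V → V, ∀ v ∈ D \ Y, carry v ∈ D ∧ G.dir v (carry v) := by
    choose! f hf using h.exists_child_left
    exact ⟨f, hf⟩
  obtain ⟨next, hnext⟩ : ∃ next : V → V, ∀ v ∈ T \ E, next v ∈ T ∧ G.dir v (next v) := by
    choose! f hf using h.exists_child_right
    exact ⟨f, hf⟩
  have hEX : Disjoint E X := h.disjoint.mono_left h.subset_left
  let p : ParityScheme G Y D E T := ⟨next, carry, hG, h.subset_left, h.subset_right,
    fun v hv => (hnext v hv).1, fun v hv => (hnext v hv).2, fun v hv => (hcarry v hv).1,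
    fun v hv => (hcarry v hv).2⟩
  let q : ParityScheme G Y D E E := ⟨next, carry, hG, h.subset_left, subset_rfl,
    fun v hv => absurd hv.1 hv.2, fun v hv => absurd hv.1 hv.2, fun v hv => (hcarry v hv).1,
    fun v hv => (hcarry v hv).2⟩
  have hobs (a) : p.model.obs a = q.model.obs a := by
    refine mul_right_cancel₀ (pow_ne_zero (Fintype.card V) (two_ne_zero (α := ℝ))) ?_
    rw [p.obs_model h.nonempty h.biConnected_right, q.obs_model h.nonempty h.biConnected_left]
  have heff := hid _ p.model q.model p.isSemiMarkovian_model p.inducedGraph_model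
    (p.positive_model h.nonempty h.biConnected_right) q.isSemiMarkovian_model q.inducedGraph_model
    (q.positive_model h.nonempty h.biConnected_left) hobs
  -- the vertices of `T` from which `next` leads to `E` without meeting `X`
  let A : Set V := {v | ∃ e ∈ E, Relation.ReflTransGen
    (fun v w => (v ∈ T \ E ∧ v ∉ X) ∧ next v = w) v e}
  have hEA : E ⊆ A := fun e he => ⟨e, he, .refl⟩
  have hA (v) (hv : v ∈ A) : v ∈ E ∨ (v ∈ T \ E ∧ v ∉ X) ∧ next v ∈ A := by
    obtain ⟨e, he, hve⟩ := hv
    rcases hve.cases_head with rfl | ⟨w, ⟨hv, rfl⟩, hw⟩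
    · exact .inl he
    · exact .inr ⟨hv, e, he, hw⟩
  have hAT : A ⊆ T := fun v hv => (hA v hv).elim (h.subset_right ·) (·.1.1.1)
  have hAX : Disjoint A X := Set.disjoint_left.2 fun v hv =>
    (hA v hv).elim (Set.disjoint_left.1 hEX ·) (·.1.2)
  have hp := p.sum_bitSign_mul_effect h.disjoint hAX hEA hAT
    (fun v hv => ((hA v hv.1).resolve_left hv.2).2)
    fun v hv hvX ⟨e, he, hve⟩ => ⟨e, he, .head ⟨⟨hv, hvX⟩, rfl⟩ hve⟩
  have hq := q.sum_bitSign_mul_effect h.disjoint hEX subset_rfl subset_rfl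
    (fun v hv => absurd hv.1 hv.2) fun v hv => absurd hv.1 hv.2
  simp only [heff] at hp
  rw [hp] at hq
  have hAT' : A ≠ T := fun e => by
    obtain ⟨v, hvT, hvX⟩ := h.inter_nonempty
    exact Set.disjoint_left.1 hAX (e ▸ hvT) hvX
  obtain ⟨j, hj⟩ := not_forall.1 fun hz => hAT' <|
    (ParityScheme.contribution_inl_eq_zero_iff (D := D) (E := E) h.biConnected_right
      (h.nonempty.mono hEA)).1 hz
  rw [Finset.prod_eq_zero (Finset.mem_univ (.inl j))] at hq
  · refine Finset.prod_ne_zero_iff.2 (fun i _ => ?_) hq.symm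
    rcases i with j | i
    · rw [if_pos <|
        (ParityScheme.contribution_inl_eq_zero_iff h.biConnected_left h.nonempty).2 rfl j]
      exact one_ne_zero
    · split_ifs
      · exact one_ne_zero
      · norm_num [ParityScheme.bias]
  · rw [if_neg hj]
    rfl

/-- Identifiability, which is about semi-Markovian models only, entails that the effects are
determined in all models with independent unobserved variables. -/
theorem Identifiable.effect_eq {V : Type} [Finite V] {α : V → Type} [∀ v, Finite (α v)]
    [∀ v, Nonempty (α v)] {G : MixedGraph V} (hG : G.IsSMG) {X Y : Set V} (hXY : Disjoint X Y)
    (hid : Identifiable G X Y) {M₁ M₂ : CausalModel α} (h₁ : M₁.inducedGraph = G)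
    (h₂ : M₂.inducedGraph = G) (hI₁ : M₁.Independent) (hI₂ : M₂.Independent) (hP : M₂.Positive)
    (hobs : ∀ a, M₁.obs a = M₂.obs a) (x y : ∀ v, α v) :
    M₁.effect X x Y y = M₂.effect X x Y y := by
  by_contra hne
  obtain ⟨D, E, T, h⟩ := MixedGraph.exists_isHedge hG hXY h₁ h₂ hI₁ hI₂ hP hobs hne
  exact h.not_identifiable hG hid

/-! ### Elimination of variables -/

namespace MixedGraph

variable {V : Type} {G : MixedGraph V} {S : Set V}

theorem DirWalk.cons {v m w : V} (h : G.dir v m) (hm : m ∉ S) (hw : G.DirWalk S m w) :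
    G.DirWalk S v w := by
  induction hw with
  | edge h' => exact .snoc (.edge h) hm h'
  | snoc _ hm' h' ih => exact .snoc ih hm' h'

theorem DirWalk.transGen {v w : V} (h : G.DirWalk S v w) : Relation.TransGen G.dir v w := by
  induction h with
  | edge h => exact .single h
  | snoc _ _ h ih => exact ih.tail h

theorem OpenWalk.cons {v m w : V} {a b c d : Bool} (h : G.Edge v a m b) (hm : m ∉ S)
    (hbc : ¬ (b = true ∧ c = true)) (hw : G.OpenWalk S m c w d) : G.OpenWalk S v a w d := by
  induction hw with
  | edge h' => exact .snoc (.edge h) hm hbc h'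
  | snoc _ hm' hbc' h' ih => exact .snoc (ih hbc) hm' hbc' h'

theorem OpenWalk.append_dirWalk {v m w : V} {a b : Bool} (h : G.OpenWalk S v a m b) (hm : m ∉ S)
    (hw : G.DirWalk S m w) : G.OpenWalk S v a w true := by
  induction hw with
  | edge h' => exact .snoc h hm (by simp) (.right h')
  | snoc _ hm' h' ih => exact .snoc ih hm' (by simp) (.right h')

theorem DirWalk.openWalk_reverse {v w : V} (h : G.DirWalk S v w) :
    G.OpenWalk S w true v false := by
  induction h with
  | edge h => exact .edge (.left h)
  | snoc _ hm h ih => exact .cons (.left h) hm (by simp) ih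

/-- Two directed walks, the tops of which coincide or are joined by a bidirected edge, form a
collider-free walk. -/
theorem openWalk_of_tops {v w v' w' : V} (hvw : v ≠ w)
    (hv : v' = v ∨ v' ∉ S ∧ G.DirWalk S v' v) (hw : w' = w ∨ w' ∉ S ∧ G.DirWalk S w' w)
    (hvw' : v' = w' ∨ G.bi v' w') (hvS : v ∈ S) (hwS : w ∈ S) : G.OpenWalk S v true w true := by
  rcases hv with rfl | ⟨hv', hv⟩
  · rcases hw with rfl | ⟨hw', hw⟩
    · exact .edge (.both (hvw'.resolve_left hvw))
    · rcases hvw' with rfl | h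
      · exact absurd hvS hw'
      · exact OpenWalk.append_dirWalk (.edge (.both h)) hw' hw
  · rcases hvw' with rfl | h
    · rcases hw with rfl | ⟨-, hw⟩
      · exact absurd hwS hv'
      · exact hv.openWalk_reverse.append_dirWalk hv' hw
    · have h' : G.OpenWalk S v true w' true := .snoc hv.openWalk_reverse hv' (by simp) (.both h)
      rcases hw with rfl | ⟨hw', hw⟩
      · exact h'
      · exact h'.append_dirWalk hw' hw

end MixedGraph

namespace CausalModel

variable {V : Type} [Finite V] {α : V → Type} [∀ v, Nonempty (α v)] (M : CausalModel α)
  (h : ∀ v, ¬ Relation.TransGen M.inducedGraph.dir v v) (S : Set V)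

open Classical in
/-- The values of all variables if those in `S` have the values `b`, and the unobserved variables
the values `u`. -/
noncomputable def fill (b : ∀ v : S, α v) (u : ∀ i, M.dom i) : ∀ v, α v :=
  (existsUnique_isSolution _ (M.intervene_acyclic h S fun v =>
    if hv : v ∈ S then b ⟨v, hv⟩ else Classical.arbitrary (α v)) u).choose

theorem eq_fill_iff {b : ∀ v : S, α v} {u : ∀ i, M.dom i} {a : ∀ v, α v} :
    a = M.fill h S b u ↔ (∀ v : S, a v = b v) ∧ ∀ v ∉ S, a v = M.f v a u := by
  classical
  have hu := existsUnique_isSolution _ (M.intervene_acyclic h S fun v =>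
    if hv : v ∈ S then b ⟨v, hv⟩ else Classical.arbitrary (α v)) u
  have : a = M.fill h S b u ↔ (M.intervene S fun v =>
      if hv : v ∈ S then b ⟨v, hv⟩ else Classical.arbitrary (α v)).IsSolution u a :=
    ⟨fun e => e ▸ hu.choose_spec.1, hu.choose_spec.2 a⟩
  rw [this, isSolution_intervene]
  refine and_congr_left fun _ => ?_
  rw [Subtype.forall]
  refine forall₂_congr fun v hv => ?_
  rw [dif_pos hv]

/-- The model over `S` in which the variables outside `S` are eliminated by substitution. Its
unobserved variables are those of the given model; the ones that enter the variables outside `S`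
may come to appear in any number of functions. -/
noncomputable def project [∀ v, Finite (α v)] : CausalModel (fun v : S => α v) where
  U := M.U
  dom := M.dom
  P := M.P
  pa v := {w | w ≠ v ∧ M.inducedGraph.DirWalk S w v}
  upa v := {i | ∃ z, (z = (v : V) ∨ z ∉ S ∧ M.inducedGraph.DirWalk S z v) ∧ i ∈ M.upa z}
  f v b u := M.f v (M.fill h S b u) u
  self_notMem_pa v hv := hv.1 rfl
  f_congr v b b' u u' hb hu := by
    have hfill := (M.eq_fill_iff h S (b := b) (u := u)).1 rfl
    have hfill' := (M.eq_fill_iff h S (b := b') (u := u')).1 rfl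
    have hS (w : V) (hw : w ∈ S) (hwv : M.inducedGraph.DirWalk S w v) :
        M.fill h S b u w = M.fill h S b' u' w := by
      rw [hfill.1 ⟨w, hw⟩, hfill'.1 ⟨w, hw⟩]
      exact hb ⟨w, hw⟩ ⟨fun e => h v (by simpa [← e] using hwv.transGen), hwv⟩
    have hSc (z : V) : z ∉ S → M.inducedGraph.DirWalk S z v →
        M.fill h S b u z = M.fill h S b' u' z := by
      let r := Relation.TransGen M.inducedGraph.dir
      have : Std.Irrefl r := ⟨h⟩
      have : IsTrans V r := ⟨fun _ _ _ => Relation.TransGen.trans⟩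
      have wf : WellFounded r := Finite.wellFounded_of_trans_of_irrefl r
      induction z using wf.induction with
      | _ z ih =>
        intro hz hzv
        rw [hfill.2 z hz, hfill'.2 z hz]
        refine M.f_congr z _ _ _ _ (fun w hw => ?_) fun i hi => hu i ⟨z, .inr ⟨hz, hzv⟩, hi⟩
        -- a parent of `z` inherits the directed walk to `v` from `z`
        have hwv : M.inducedGraph.DirWalk S w v := .cons hw hz hzv
        by_cases hwS : w ∈ S
        · exact hS w hwS hwv
        · exact ih w (.single hw) hwS hwv
    refine M.f_congr v _ _ _ _ (fun w hw => ?_) fun i hi => hu i ⟨v, .inl rfl, hi⟩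
    by_cases hwS : w ∈ S
    · exact hS w hwS (.edge hw)
    · exact hSc w hwS (.edge hw)
  measurableSet_f v b s := by
    have heq : {u | M.f v (M.fill h S b u) u = s} =
        ⋃ a ∈ {a : ∀ v, α v | ∀ v : S, a v = b v},
          {u | ∀ v ∈ Sᶜ, M.f v a u = a v} ∩ {u | M.f v a u = s} := by
      ext u
      simp only [Set.mem_iUnion, Set.mem_inter_iff]
      constructor
      · intro hu
        have hfill := (M.eq_fill_iff h S (b := b) (u := u)).1 rfl
        exact ⟨_, hfill.1, fun v hv => (hfill.2 v hv).symm, hu⟩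
      · rintro ⟨a, hab, ha, hu⟩
        have := (M.eq_fill_iff h S).2 ⟨hab, fun v hv => (ha v hv).symm⟩
        rw [this] at hu
        exact hu
    rw [heq]
    exact MeasurableSet.biUnion (Set.to_countable _) fun a _ =>
      (M.measurableSet_forall_f _ a).inter (M.measurableSet_f v a s)

variable [∀ v, Finite (α v)]

theorem inducedGraph_project
    (hS : M.inducedGraph.induce S = M.inducedGraph.latentProjection S) :
    (M.project h S).inducedGraph = M.inducedGraph.induce S := by
  ext v w
  · rw [hS]
    rfl
  · constructor
    · rintro ⟨hvw, i, ⟨z, hz, hi⟩, z', hz', hi'⟩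
      rw [hS]
      refine ⟨hvw, MixedGraph.openWalk_of_tops (fun e => hvw (Subtype.ext e)) hz hz' ?_ v.2 w.2⟩
      by_cases hzz : z = z'
      · exact .inl hzz
      · exact .inr ⟨hzz, i, hi, hi'⟩
    · rintro ⟨hvw, i, hi, hi'⟩
      exact ⟨fun e => hvw (congrArg _ e), i, ⟨v, .inl rfl, hi⟩, w, .inl rfl, hi'⟩

theorem isSolution_project {u : ∀ i, M.dom i} {b : ∀ v : S, α v} :
    (M.project h S).IsSolution u b ↔ ∃ a, (∀ v : S, a v = b v) ∧ M.IsSolution u a := by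
  have hfill := (M.eq_fill_iff h S (b := b) (u := u)).1 rfl
  constructor
  · refine fun hb => ⟨M.fill h S b u, hfill.1, fun v => ?_⟩
    by_cases hv : v ∈ S
    · exact (hfill.1 ⟨v, hv⟩).trans (hb ⟨v, hv⟩)
    · exact hfill.2 v hv
  · rintro ⟨a, hab, ha⟩ v
    have := (M.eq_fill_iff h S).2 ⟨hab, fun v _ => ha v⟩
    rw [← hab v, ha v, this]
    rfl

theorem isSolution_intervene_project {X : Set V} (hX : X ⊆ S) {x : ∀ v, α v} {u : ∀ i, M.dom i}
    {b : ∀ v : S, α v} :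
    ((M.project h S).intervene (Subtype.val ⁻¹' X) fun v => x v).IsSolution u b ↔
      ∃ a, (∀ v : S, a v = b v) ∧ (M.intervene X x).IsSolution u a := by
  have hfill := (M.eq_fill_iff h S (b := b) (u := u)).1 rfl
  refine (isSolution_intervene _).trans ?_
  constructor
  · rintro ⟨h₁, h₂⟩
    refine ⟨M.fill h S b u, hfill.1, (isSolution_intervene _).2 ⟨fun v hv => ?_, fun v hv => ?_⟩⟩
    · exact (hfill.1 ⟨v, hX hv⟩).trans (h₁ ⟨v, hX hv⟩ hv)
    · by_cases hvS : v ∈ S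
      · exact (hfill.1 ⟨v, hvS⟩).trans (h₂ ⟨v, hvS⟩ hv)
      · exact hfill.2 v hvS
  · rintro ⟨a, hab, ha⟩
    obtain ⟨h₁, h₂⟩ := (isSolution_intervene _).1 ha
    have := (M.eq_fill_iff h S).2 ⟨hab, fun v hv => h₂ v fun hvX => hv (hX hvX)⟩
    refine ⟨fun v hv => (hab v).symm.trans (h₁ v hv), fun v hv => ?_⟩
    rw [← hab v, h₂ v hv, this]
    rfl

theorem obs_project (b : ∀ v : S, α v) : (M.project h S).obs b = M.marginal S b := by
  unfold obs marginal prob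
  change M.P.real _ = M.P.real _
  congr 1
  ext u
  refine Iff.trans ?_ ((M.isSolution_project h S).trans Iff.rfl)
  exact ⟨fun ⟨a, ha, hu⟩ => (ha : a = b) ▸ hu, fun hu => ⟨b, rfl, hu⟩⟩

theorem effect_project {X Y : Set V} (hX : X ⊆ S) (hY : Y ⊆ S) (x y : ∀ v, α v) :
    (M.project h S).effect (Subtype.val ⁻¹' X) (fun v => x v) (Subtype.val ⁻¹' Y)
      (fun v => y v) = M.effect X x Y y := by
  unfold effect marginal prob
  change M.P.real _ = M.P.real _
  congr 1
  ext u
  constructor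
  · rintro ⟨b, hb, hu⟩
    obtain ⟨a, hab, ha⟩ := (M.isSolution_intervene_project h S hX).1 hu
    exact ⟨a, fun v => (hab ⟨v, hY v.2⟩).trans (hb ⟨⟨v, hY v.2⟩, v.2⟩), ha⟩
  · rintro ⟨a, ha, hu⟩
    exact ⟨fun v => a v, fun v => ha ⟨v, v.2⟩,
      (M.isSolution_intervene_project h S hX).2 ⟨a, fun _ => rfl, hu⟩⟩

end CausalModel

/-! ### Extension by variables with trivial domains -/

open ProbabilityTheory

namespace CausalModel

theorem measurableSet_exists_isSolution {V : Type} [Finite V] {α : V → Type} [∀ v, Finite (α v)]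
    (M : CausalModel α) (E : Set (∀ v, α v)) :
    MeasurableSet {u | ∃ a ∈ E, M.IsSolution u a} := by
  have : {u | ∃ a ∈ E, M.IsSolution u a} =
      ⋃ a ∈ E, {u | ∀ v ∈ Set.univ, M.f v a u = a v} := by
    ext u
    simp [IsSolution, eq_comm]
  rw [this]
  exact MeasurableSet.biUnion (Set.to_countable _) fun a _ => M.measurableSet_forall_f _ a

variable {V : Type} {S : Set V} {α : S → Type} (M : CausalModel α)

/-- The domains of the unobserved variables of `extend`: those of the given model, and trivial ones
for the new variables, which are indexed by pairs of vertices. -/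
def extendDom : M.U ⊕ (V × V) → Type := Sum.elim M.dom fun _ => Unit

instance (i : M.U ⊕ (V × V)) : MeasurableSpace (M.extendDom i) :=
  match i with
  | .inl i => M.measurableDom i
  | .inr _ => inferInstanceAs (MeasurableSpace Unit)

/-- The values of the unobserved variables of `extend` that correspond to those of the given
model. -/
def extendNoise (u : ∀ i, M.dom i) : ∀ i, M.extendDom i
  | .inl i => u i
  | .inr _ => ()

theorem measurable_extendNoise : Measurable M.extendNoise :=
  measurable_pi_lambda _ fun
    | .inl i => measurable_pi_apply i
    | .inr _ => measurable_const

theorem measurable_restrictNoise :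
    Measurable fun (u : ∀ i, M.extendDom i) (i : M.U) => (u (.inl i) : M.dom i) :=
  measurable_pi_lambda _ fun i => measurable_pi_apply (Sum.inl i)

theorem iIndepFun_extendNoise (hI : M.Independent) [Finite V] :
    iIndepFun (fun i (u : ∀ i, M.extendDom i) => u i) (M.P.map M.extendNoise) := by
  classical
  refine iIndepFun_iff_measure_inter_preimage_eq_mul.2 fun T sets hsets => ?_
  have hind := hI.measure_inter_preimage_eq_mul T.toLeft (sets := fun i => sets (.inl i))
    fun i hi => hsets _ (Finset.mem_toLeft.1 hi)
  have hm : ∀ i ∈ T, MeasurableSet ((fun u : ∀ i, M.extendDom i => u i) ⁻¹' sets i) :=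
    fun i hi => measurable_pi_apply i (hsets i hi)
  rw [Measure.map_apply M.measurable_extendNoise (T.measurableSet_biInter hm),
    Finset.prod_congr rfl fun i hi => Measure.map_apply M.measurable_extendNoise (hm i hi)]
  by_cases h : ∀ q ∈ T.toRight, (() : M.extendDom (.inr q)) ∈ sets (.inr q)
  · have hset : M.extendNoise ⁻¹' ⋂ i ∈ T, (fun u : ∀ i, M.extendDom i => u i) ⁻¹' sets i =
        ⋂ i ∈ T.toLeft, (fun u : ∀ i, M.dom i => u i) ⁻¹' sets (.inl i) := by
      ext u
      simp only [Set.mem_preimage, Set.mem_iInter, Finset.mem_toLeft]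
      refine ⟨fun hu i hi => hu _ hi, fun hu i hi => ?_⟩
      rcases i with i | q
      · exact hu i hi
      · exact h q (Finset.mem_toRight.2 hi)
    rw [hset, hind]
    conv_rhs => rw [← Finset.toLeft_disjSum_toRight (u := T), Finset.prod_disjSum]
    refine (mul_one _).symm.trans (congrArg₂ _ rfl (Finset.prod_eq_one fun q hq => ?_).symm)
    have hset : M.extendNoise ⁻¹'
        ((fun u : ∀ i, M.extendDom i => u (.inr q)) ⁻¹' sets (.inr q)) = Set.univ :=
      Set.eq_univ_of_forall fun u => h q hq
    rw [hset, measure_univ]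
  · push Not at h
    obtain ⟨q, hq, hqs⟩ := h
    have hq := Finset.mem_toRight.1 hq
    have hset : M.extendNoise ⁻¹'
        ((fun u : ∀ i, M.extendDom i => u (.inr q)) ⁻¹' sets (.inr q)) = ∅ :=
      Set.eq_empty_of_forall_notMem fun u hu => hqs hu
    rw [Finset.prod_eq_zero hq (by rw [hset, measure_empty])]
    exact measure_mono_null (Set.preimage_mono (Set.biInter_subset_of_mem hq))
      (by rw [hset, measure_empty])

/-- The extension of a model over `S` to a graph `G` on a larger set of vertices. The functions
from the proposition `v ∈ S` form the domain of `v`; it is the given one if `v` belongs to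
`S`, and trivial otherwise. The edges of `G` are provided by arguments that the functions do not
depend on. -/
noncomputable def extend [Finite V] (G : MixedGraph V) (hG : ∀ v, ¬ G.dir v v)
    (hM : M.inducedGraph = G.induce S) : CausalModel (fun v => ∀ h : v ∈ S, α ⟨v, h⟩) where
  U := M.U ⊕ (V × V)
  fintypeU := Fintype.ofFinite _
  dom := M.extendDom
  P := M.P.map M.extendNoise
  isProbabilityMeasure := Measure.isProbabilityMeasure_map M.measurable_extendNoise.aemeasurable
  pa v := {w | G.dir w v}
  upa v := {i | Sum.elim (fun i => ∃ h : v ∈ S, i ∈ M.upa ⟨v, h⟩)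
    (fun q => G.bi q.1 q.2 ∧ (v = q.1 ∨ v = q.2)) i}
  f v a u := fun h => M.f ⟨v, h⟩ (fun w => a w w.2) fun i => u (.inl i)
  self_notMem_pa v h := hG v h
  f_congr v a a' u u' ha hu := by
    funext h
    refine M.f_congr _ _ _ _ _ (fun w hw => ?_) fun i hi => hu (.inl i) ⟨h, hi⟩
    have hw' : M.inducedGraph.dir w ⟨v, h⟩ := hw
    rw [hM] at hw'
    rw [ha w hw']
  measurableSet_f v a s := by
    by_cases h : v ∈ S
    · have := M.measurable_restrictNoise (M.measurableSet_f ⟨v, h⟩ (fun w => a w w.2) (s h))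
      convert this using 1
      ext u
      exact ⟨fun e => congrFun e h, fun e => funext fun _ => e⟩
    · convert MeasurableSet.univ
      exact Set.eq_univ_of_forall fun u => funext fun h' => absurd h' h

variable [Finite V] {G : MixedGraph V} (hG' : ∀ v, ¬ G.dir v v)
  (hM : M.inducedGraph = G.induce S)

theorem inducedGraph_extend (hG : G.IsSMG) : (M.extend G hG' hM).inducedGraph = G := by
  ext v w
  · rfl
  · constructor
    · rintro ⟨hvw, i | q, hv, hw⟩
      · obtain ⟨hvS, hv⟩ := hv
        obtain ⟨hwS, hw⟩ := hw
        have : M.inducedGraph.bi ⟨v, hvS⟩ ⟨w, hwS⟩ :=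
          ⟨fun e => hvw (congrArg Subtype.val e), i, hv, hw⟩
        rw [hM] at this
        exact this
      · obtain ⟨h, rfl | rfl⟩ := hv <;> obtain ⟨-, rfl | rfl⟩ := hw
        · exact absurd rfl hvw
        · exact h
        · exact hG.bi_symm _ _ h
        · exact absurd rfl hvw
    · intro h
      exact ⟨fun e => hG.bi_irrefl v (by rwa [← e] at h), .inr (v, w),
        ⟨h, .inl rfl⟩, ⟨h, .inr rfl⟩⟩

theorem independent_extend (hI : M.Independent) : (M.extend G hG' hM).Independent :=
  M.iIndepFun_extendNoise hI

theorem isSemiMarkovian_extend (hG : G.IsSMG) (h : M.IsSemiMarkovian) :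
    (M.extend G hG' hM).IsSemiMarkovian where
  independent := M.independent_extend hG' hM h.independent
  encard_le_two i := by
    rcases i with i | q
    · refine (Set.encard_le_encard (t := Subtype.val '' {v | i ∈ M.upa v}) ?_).trans ?_
      · rintro v ⟨hv, h⟩
        exact ⟨⟨v, hv⟩, h, rfl⟩
      · rw [Subtype.val_injective.encard_image]
        exact h.encard_le_two i
    · refine (Set.encard_le_encard (t := {q.1, q.2}) fun v h => h.2).trans ?_
      refine (Set.encard_insert_le _ _).trans ?_
      rw [Set.encard_singleton, one_add_one_eq_two]
  acyclic := by
    rw [M.inducedGraph_extend hG' hM hG]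
    exact hG.acyclic

theorem isSolution_intervene_extend {X : Set V} {x a : ∀ v, ∀ h : v ∈ S, α ⟨v, h⟩}
    {u : ∀ i, M.extendDom i} :
    ((M.extend G hG' hM).intervene X x).IsSolution u a ↔
      (M.intervene (Subtype.val ⁻¹' X) fun v => x v v.2).IsSolution (fun i => u (.inl i))
        fun v => a v v.2 := by
  refine (isSolution_intervene _).trans (Iff.trans ?_ (isSolution_intervene _).symm)
  constructor
  · rintro ⟨h₁, h₂⟩
    exact ⟨fun v hv => congrFun (h₁ v hv) v.2, fun v hv => congrFun (h₂ v hv) v.2⟩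
  · rintro ⟨h₁, h₂⟩
    exact ⟨fun v hv => funext fun h => h₁ ⟨v, h⟩ hv, fun v hv => funext fun h => h₂ ⟨v, h⟩ hv⟩

theorem isSolution_extend {a : ∀ v, ∀ h : v ∈ S, α ⟨v, h⟩} {u : ∀ i, M.extendDom i} :
    (M.extend G hG' hM).IsSolution u a ↔
      M.IsSolution (fun i => u (.inl i)) fun v => a v v.2 :=
  ⟨fun h v => congrFun (h v) v.2, fun h v => funext fun hv => h ⟨v, hv⟩⟩

theorem measureReal_extend {A : Set (∀ i, M.dom i)} (hA : MeasurableSet A) :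
    (M.extend G hG' hM).P.real {u | (fun i => u (.inl i)) ∈ A} = M.P.real A :=
  map_measureReal_apply M.measurable_extendNoise (M.measurable_restrictNoise hA)

variable [∀ v, Finite (α v)]

theorem obs_extend (a : ∀ v, ∀ h : v ∈ S, α ⟨v, h⟩) :
    (M.extend G hG' hM).obs a = M.obs fun v => a v v.2 := by
  refine Eq.trans ?_ (M.measureReal_extend hG' hM (M.measurableSet_exists_isSolution _))
  unfold obs prob
  congr 1
  ext u
  constructor
  · rintro ⟨b, rfl, hu⟩
    exact ⟨_, rfl, (M.isSolution_extend hG' hM).1 hu⟩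
  · rintro ⟨b, rfl, hu⟩
    exact ⟨_, rfl, (M.isSolution_extend hG' hM).2 hu⟩

theorem effect_extend (X Y : Set V) (x y : ∀ v, ∀ h : v ∈ S, α ⟨v, h⟩) :
    (M.extend G hG' hM).effect X x Y y = M.effect (Subtype.val ⁻¹' X) (fun v => x v v.2)
      (Subtype.val ⁻¹' Y) fun v => y v v.2 := by
  refine Eq.trans ?_ (M.measureReal_extend hG' hM ((M.intervene (Subtype.val ⁻¹' X)
    fun v => x v v.2).measurableSet_exists_isSolution _))
  unfold effect marginal prob
  change (M.extend G hG' hM).P.real _ = _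
  congr 1
  ext u
  constructor
  · rintro ⟨a, ha, hu⟩
    exact ⟨_, fun v => congrFun (ha ⟨v, v.2⟩) v.1.2, (M.isSolution_intervene_extend hG' hM).1 hu⟩
  · rintro ⟨b, hb, hu⟩
    exact ⟨fun v h => b ⟨v, h⟩, fun v => funext fun h => hb ⟨⟨v, h⟩, v.2⟩,
      (M.isSolution_intervene_extend hG' hM).2 hu⟩

end CausalModel

/-- Identifiability passes to induced subgraphs, because the other variables may be given trivial
domains. -/
theorem Identifiable.induce {V : Type} [Finite V] {G : MixedGraph V} (hG : G.IsSMG) {X Y : Set V}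
    (h : Identifiable G X Y) (S : Set V) :
    Identifiable (G.induce S) (Subtype.val ⁻¹' X) (Subtype.val ⁻¹' Y) := by
  intro α _ _ M₁ M₂ hM₁ h₁ hP₁ hM₂ h₂ hP₂ hobs x y
  have hG' : ∀ v, ¬ G.dir v v := fun v hv => hG.acyclic v (.single hv)
  have := h _ (M₁.extend G hG' h₁) (M₂.extend G hG' h₂) (M₁.isSemiMarkovian_extend hG' h₁ hG hM₁)
    (M₁.inducedGraph_extend hG' h₁ hG) (fun a => by rw [M₁.obs_extend]; exact hP₁ _)
    (M₂.isSemiMarkovian_extend hG' h₂ hG hM₂)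
    (M₂.inducedGraph_extend hG' h₂ hG) (fun a => by rw [M₂.obs_extend]; exact hP₂ _)
    (fun a => by rw [M₁.obs_extend, M₂.obs_extend, hobs]) (fun v hv => x ⟨v, hv⟩)
    (fun v hv => y ⟨v, hv⟩)
  rwa [M₁.effect_extend, M₂.effect_extend] at this

/-! ### Reduction to the vertices that are not intercepted -/

theorem MixedGraph.IsSMG.induce {V : Type} {G : MixedGraph V} (hG : G.IsSMG) (S : Set V) :
    (G.induce S).IsSMG where
  acyclic v h := hG.acyclic v (Relation.TransGen.lift Subtype.val (fun _ _ h => h) _ _ h)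
  bi_symm _ _ h := hG.bi_symm _ _ h
  bi_irrefl _ h := hG.bi_irrefl _ h

/-- The path of length zero from a vertex of `Y` contains nothing but its starting point. -/
theorem MixedGraph.subset_compl_intercepted {V : Type} (G : MixedGraph V) (X Y : Set V) :
    Y ⊆ (G.intercepted X Y)ᶜ := by
  intro y hy h
  obtain ⟨x, hx, -, hxy⟩ := h y hy .nil .nil
  exact hxy (by simpa using hx)

namespace CausalModel

variable {V : Type} [Finite V] {α : V → Type} [∀ v, Finite (α v)] [∀ v, Nonempty (α v)]

theorem marginal_eq_of_obs_eq {M₁ M₂ : CausalModel α}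
    (h₁ : ∀ v, ¬ Relation.TransGen M₁.inducedGraph.dir v v)
    (h₂ : ∀ v, ¬ Relation.TransGen M₂.inducedGraph.dir v v)
    (h : ∀ a, M₁.obs a = M₂.obs a) (S : Set V) (b : ∀ v : S, α v) :
    M₁.marginal S b = M₂.marginal S b := by
  simp only [marginal, prob_eq_sum_obs _ h₁, prob_eq_sum_obs _ h₂, h]

theorem marginal_pos {M : CausalModel α}
    (h : ∀ v, ¬ Relation.TransGen M.inducedGraph.dir v v) (hP : M.Positive) (S : Set V)
    (b : ∀ v : S, α v) : 0 < M.marginal S b := by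
  classical
  rw [marginal, prob_eq_sum_obs _ h]
  refine Finset.sum_pos (fun a _ => hP a)
    ⟨fun v => if hv : v ∈ S then b ⟨v, hv⟩ else Classical.arbitrary _, ?_⟩
  simp only [Set.Finite.mem_toFinset, Set.mem_ofPred_eq, Subtype.forall]
  exact fun v hv => dif_pos hv

end CausalModel

theorem mainTheorem1 {V : Type} [Finite V] (G : MixedGraph V) (hG : G.IsSMG)
    (X Y : Set V) (hXY : Disjoint X Y)
    (Z : Set V) (hZ : Z = G.intercepted X Y) (hZX : Disjoint Z X)
    (hL : G.induce Zᶜ = G.latentProjection Zᶜ) :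
    -- identifiability from `P` in `G` and from `P'` in `G[V \ Z]` amount to the same
    (Identifiable G X Y ↔
      Identifiable (G.induce Zᶜ) (Subtype.val ⁻¹' X) (Subtype.val ⁻¹' Y)) ∧
    ∀ (α : V → Type) [∀ v, Finite (α v)] [∀ v, Nonempty (α v)] (M : CausalModel α),
      M.IsSemiMarkovian → M.inducedGraph = G →
      -- `P' = P(V \ Z)` arises in `G[V \ Z]`, with the causal effects that `M` has
      (∃ M' : CausalModel (fun v : ↥Zᶜ => α v),
        M'.Independent ∧ M'.inducedGraph = G.induce Zᶜ ∧
        (∀ a, M'.obs a = M.marginal Zᶜ a) ∧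
        ∀ x y : ∀ v, α v, M.effect X x Y y =
          M'.effect (Subtype.val ⁻¹' X) (fun v => x v) (Subtype.val ⁻¹' Y) (fun v => y v)) ∧
      -- in the identifiable case, what is obtained from `P'` in `G[V \ Z]` is the effect in `M`
      (Identifiable (G.induce Zᶜ) (Subtype.val ⁻¹' X) (Subtype.val ⁻¹' Y) →
        ∀ M' : CausalModel (fun v : ↥Zᶜ => α v),
          M'.Independent → M'.inducedGraph = G.induce Zᶜ → M'.Positive →
          (∀ a, M'.obs a = M.marginal Zᶜ a) →
          ∀ x y : ∀ v, α v, M.effect X x Y y =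
            M'.effect (Subtype.val ⁻¹' X) (fun v => x v) (Subtype.val ⁻¹' Y)
              (fun v => y v)) := by
  have hY : Y ⊆ Zᶜ := hZ ▸ G.subset_compl_intercepted X Y
  have hX : X ⊆ Zᶜ := fun x hx hxZ => Set.disjoint_left.1 hZX hxZ hx
  have hG' := hG.induce Zᶜ
  have hXY' : Disjoint (Subtype.val ⁻¹' X : Set ↥Zᶜ) (Subtype.val ⁻¹' Y) := hXY.preimage _
  refine ⟨⟨fun h => h.induce hG Zᶜ, ?_⟩, ?_⟩
  · intro hid α _ _ M₁ M₂ hM₁ h₁ hP₁ hM₂ h₂ hP₂ hobs x y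
    rw [← M₁.effect_project hM₁.acyclic Zᶜ hX hY, ← M₂.effect_project hM₂.acyclic Zᶜ hX hY]
    refine hid.effect_eq hG' hXY' ?_ ?_ hM₁.independent hM₂.independent (fun a => ?_)
      (fun a => ?_) _ _
    · rw [M₁.inducedGraph_project _ _ (by rw [h₁, hL]), h₁]
    · rw [M₂.inducedGraph_project _ _ (by rw [h₂, hL]), h₂]
    · rw [M₂.obs_project]
      exact CausalModel.marginal_pos hM₂.acyclic hP₂ _ _
    · rw [M₁.obs_project, M₂.obs_project]
      exact CausalModel.marginal_eq_of_obs_eq hM₁.acyclic hM₂.acyclic hobs _ _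
  · intro α _ _ M hM h
    have hproj : (M.project hM.acyclic Zᶜ).inducedGraph = G.induce Zᶜ := by
      rw [M.inducedGraph_project _ _ (by rw [h, hL]), h]
    refine ⟨⟨M.project hM.acyclic Zᶜ, hM.independent, hproj, M.obs_project _ _,
      fun x y => (M.effect_project _ _ hX hY x y).symm⟩, fun hid M' hI' h' hP' hobs' x y => ?_⟩
    rw [← M.effect_project hM.acyclic Zᶜ hX hY]
    exact hid.effect_eq hG' hXY' hproj h' hM.independent hI' hP'
      (fun a => (M.obs_project _ _ a).trans (hobs' a).symm) _ _
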